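/- Let $n\ge 4$ be even and let $(M,g)$ be a compact smooth $n$-manifold (without boundary, not necessarily orientable) with a pseudo-Riemannian metric $g$ of any signature which is Einstein, i.e. $\mathrm{Ric}=c\,g$ for a constant $c$, and not Ricci-flat. Let $J$ be the trace of the Schouten tensor $P$ of $g$, defined by $\mathrm{Ric}=(n-2)P+Jg$. Let $\mathcal E^k$ be the space of smooth $k$-forms, $d$ the exterior derivative, $\langle\varphi,\psi\rangle=\int_M\varphi\cdot\psi\,d\mu_g$ the global pairing of $k$-forms (where $\varphi\cdot\psi=\frac1{k!}\varphi_{a_1\cdots a_k}\psi^{a_1\cdots a_k}$ and $\mu_g$ is the volume density of $g$), and $\delta:\mathcal E^{k}\to\mathcal E^{k-1}$ the formal adjoint of $d$ for this pairing ($\delta=0$ on functions). Then $J$ is a nonzero constant. For $k\in\{0,1,\dots,n/2\}$ put $$Q_k=\prod_{i=1}^{(n-2k)/2}\Bigl(d\delta+\frac{2i(n-2k-i+1)}{n}J\Bigr):\mathcal E^k\to\mathcal E^k,\qquad s^k=\prod_{i=1}^{(n-2k)/2}\frac{2i(n-2k-i+1)}{n}$$ (empty products being the identity and $1$ respectively),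 $G_k=\delta Q_k$, and $$\mathcal H^k_G=\{u\in\mathcal E^k: du=0,\ G_ku=0\},\qquad \mathcal H^k_\sigma=\{u\in\mathcal E^k: du=0,\ \delta u=0\},$$ $$\overline{\mathcal H}{}^k_i=\Bigl\{f\in\mathcal E^k: d\delta f=-\frac{2i(n-2k-i+1)}{n}J f\Bigr\}.$$ Then $\mathcal H^k_G=\mathcal H^k_\sigma\oplus\bigoplus_{i=1}^{(n-2k)/2}\overline{\mathcal H}{}^k_i$, and the quadratic form $$\tilde\Theta:\mathcal H^k_G\times\mathcal H^k_G\to\mathbb R,\qquad \tilde\Theta(u,w)=\langle u,Q_kw\rangle,$$ descends along the projection $\pi:\mathcal H^k_G\to\mathcal H^k_\sigma$ of this decomposition to the form $(u,w)\mapsto s^kJ^{(n-2k)/2}\langle u,w\rangle$ on $\mathcal H^k_\sigma\times\mathcal H^k_\sigma$; that is, $$\tilde\Theta(u,w)=s^kJ^{\frac{n-2k}{2}}\langle\pi u,\pi w\rangle\qquad\text{for all }u,w\in\mathcal H^k_G.$$ -/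

import Mathlib

open Set Filter
open scoped Manifold ContDiff Topology

noncomputable section

namespace PseudoRiem

/-- The model space `ℝⁿ`. -/
abbrev E (n : ℕ) : Type := EuclideanSpace ℝ (Fin n)

/-- The standard basis vector `eᵢ` of `ℝⁿ`. -/
def e {n : ℕ} (i : Fin n) : E n := EuclideanSpace.single i 1

section Forms

variable {n : ℕ} {M : Type*} [TopologicalSpace M] [ChartedSpace (E n) M]
  [IsManifold (𝓡 n) ∞ M] {k : ℕ}

/-- The preferred chart of `M` at `x`. -/
def chart (x : M) : PartialEquiv M (E n) := extChartAt (𝓡 n) x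

/-- For `y` in the target of the chart at `x`, and `z` the point of `M` with coordinates `y`: the
linear map `ℝⁿ → T_z M` taking the coordinates of a tangent vector in the chart at `x` to that
vector, i.e. the derivative of the inverse chart at `y`.  (In Mathlib `T_z M` is the copy of `ℝⁿ`
given by the preferred chart at `z`.) -/
def frame (x : M) (y : E n) : E n →L[ℝ] TangentSpace (𝓡 n) ((chart x).symm y) :=
  tangentCoordChange (𝓡 n) x ((chart x).symm y) ((chart x).symm y)

variable (n M k) in
/-- Fields of alternating `k`-linear forms on the tangent spaces (no regularity). -/
abbrev RawForm : Type _ := (z : M) → (TangentSpace (𝓡 n) z) [⋀^Fin k]→L[ℝ] ℝ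

/-- The coordinate expression in the chart at `x` of a field of alternating forms: its pullback
under the inverse chart. -/
def inChart (α : RawForm n M k) (x : M) (y : E n) : (E n) [⋀^Fin k]→L[ℝ] ℝ :=
  (α ((chart x).symm y)).compContinuousLinearMap (frame x y)

lemma inChart_add (α η : RawForm n M k) (x : M) :
    inChart (α + η) x = inChart α x + inChart η x := by
  ext y v; simp [inChart]

lemma inChart_smul (c : ℝ) (α : RawForm n M k) (x : M) :
    inChart (c • α) x = c • inChart α x := by
  ext y v; simp [inChart]

lemma inChart_zero (x : M) : inChart (0 : RawForm n M k) x = 0 := by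
  ext y v; simp [inChart]

variable (n M k) in
/-- The smooth differential `k`-forms, as a subspace of all fields of alternating forms. -/
def smoothForms : Submodule ℝ (RawForm n M k) where
  carrier := {α | ∀ x : M, ContDiffOn ℝ ∞ (inChart α x) (chart x).target}
  add_mem' h₁ h₂ x := by rw [inChart_add]; exact (h₁ x).add (h₂ x)
  zero_mem' x := by rw [inChart_zero]; exact contDiffOn_const
  smul_mem' c α h x := by rw [inChart_smul]; exact (h x).const_smul c

variable (n M k) in
/-- The space `ℰᵏ` of smooth differential `k`-forms on `M`. -/
def Form : Type _ := smoothForms n M k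

instance : AddCommGroup (Form n M k) := inferInstanceAs (AddCommGroup (smoothForms n M k))

instance : Module ℝ (Form n M k) := inferInstanceAs (Module ℝ (smoothForms n M k))

/-- The exterior derivative at `z`, computed in the preferred chart at `z`. -/
def rawExtDeriv (α : RawForm n M k) : RawForm n M (k + 1) :=
  fun z => extDeriv (inChart α z) (chart (n := n) z z)

lemma inChart_differentiableAt (α : Form n M k) (x : M) {y : E n} (hy : y ∈ (chart x).target) :
    DifferentiableAt ℝ (inChart α.1 x) y :=
  ((α.2 x).contDiffAt
    ((isOpen_extChartAt_target (I := 𝓡 n) x).mem_nhds hy)).differentiableAt (by simp)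

lemma frame_eq_fderiv (x z : M) {y : E n} (hy : y ∈ (chart x).target) :
    tangentCoordChange (𝓡 n) x z ((chart x).symm y) =
      fderiv ℝ (chart (n := n) z ∘ (chart x).symm) y := by
  have hy' : extChartAt (𝓡 n) x ((chart x).symm y) = y := (chart x).right_inv hy
  rw [tangentCoordChange_def, hy']
  simp [chart]

lemma coordChange_contDiffAt (x z : M) {y : E n} (hy : y ∈ (chart x).target)
    (hz : (chart x).symm y ∈ (chart (n := n) z).source) :
    ContDiffAt ℝ ∞ (chart (n := n) z ∘ (chart x).symm) y := by
  have h := contDiffWithinAt_ext_coord_change (I := 𝓡 n) (n := ∞) z x (y := y)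
    (by
      rw [PartialEquiv.trans_source]
      exact ⟨hy, hz⟩)
  simpa [chart, contDiffWithinAt_univ] using h

lemma inChart_eventuallyEq (α : RawForm n M k) (x z : M) {y : E n} (hy : y ∈ (chart x).target)
    (hz : (chart x).symm y ∈ (chart (n := n) z).source) :
    inChart α x =ᶠ[𝓝 y] fun y' =>
      (inChart α z ((chart (n := n) z ∘ (chart x).symm) y')).compContinuousLinearMap
        (fderiv ℝ (chart (n := n) z ∘ (chart x).symm) y') := by
  have hcont : ContinuousAt (chart (n := n) x).symm y :=
    (continuousOn_extChartAt_symm (I := 𝓡 n) x).continuousAt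
      ((isOpen_extChartAt_target (I := 𝓡 n) x).mem_nhds hy)
  filter_upwards [(isOpen_extChartAt_target (I := 𝓡 n) x).mem_nhds hy,
    hcont.preimage_mem_nhds ((isOpen_extChartAt_source (I := 𝓡 n) z).mem_nhds hz)] with y' h1 h2
  have h2' : (chart x).symm y' ∈ (chart (n := n) z).source := h2
  have hp : (chart z).symm (chart (n := n) z ((chart x).symm y')) = (chart x).symm y' :=
    (chart z).left_inv h2'
  have key : ∀ p, p = (chart x).symm y' → ∀ v : Fin k → E n,
      α ((chart x).symm y') (fun i => frame x y' (v i)) =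
      α p (fun i => tangentCoordChange (𝓡 n) z p p
        (fderiv ℝ (chart (n := n) z ∘ (chart x).symm) y' (v i))) := by
    rintro p rfl v
    congr 1
    funext i
    rw [← frame_eq_fderiv x z h1, tangentCoordChange_comp]
    · rfl
    · exact ⟨⟨(chart x).map_target h1, h2'⟩, mem_extChartAt_source _⟩
  ext v
  exact key _ hp v

lemma inChart_rawExtDeriv (α : Form n M k) (x : M) {y : E n} (hy : y ∈ (chart x).target) :
    inChart (rawExtDeriv α.1) x y = extDeriv (inChart α.1 x) y := by
  set z := (chart x).symm y with hz
  have hzs : z ∈ (chart (n := n) z).source := mem_extChartAt_source z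
  have h1 : DifferentiableAt ℝ (inChart α.1 z) ((chart (n := n) z ∘ (chart x).symm) y) :=
    inChart_differentiableAt α z ((chart (n := n) z).map_source hzs)
  have h2 : (2 : WithTop ℕ∞) ≤ ∞ := WithTop.coe_le_coe.2 (le_top : (2 : ℕ∞) ≤ ⊤)
  rw [(inChart_eventuallyEq α.1 x z hy hzs).extDeriv_eq,
    extDeriv_pullback (r := ∞) (f := chart (n := n) z ∘ (chart x).symm) h1
      (coordChange_contDiffAt x z hy hzs) (by simpa using h2),
    ← frame_eq_fderiv x z hy]
  rfl

lemma rawExtDeriv_mem (α : Form n M k) : rawExtDeriv α.1 ∈ smoothForms n M (k + 1) := by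
  intro x
  have h : ContDiffOn ℝ ∞ (fderiv ℝ (inChart α.1 x)) (chart (n := n) x).target :=
    ContDiffOn.fderiv_of_isOpen (n := ∞) (α.2 x) (isOpen_extChartAt_target (I := 𝓡 n) x) le_rfl
  refine ContDiffOn.congr ?_ fun y hy => inChart_rawExtDeriv α x hy
  exact (ContinuousAlternatingMap.alternatizeUncurryFinCLM ℝ (E n) ℝ).contDiff.comp_contDiffOn h

variable (n M k) in
/-- The exterior derivative `d : ℰᵏ → ℰᵏ⁺¹`. -/
def d : Form n M k →ₗ[ℝ] Form n M (k + 1) where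
  toFun α := ⟨rawExtDeriv α.1, rawExtDeriv_mem α⟩
  map_add' α η := by
    refine Subtype.ext (funext fun z => ?_)
    have hz : chart (n := n) z z ∈ (chart (n := n) z).target := mem_extChartAt_target z
    change extDeriv (inChart (α.1 + η.1) z) _ = _
    rw [inChart_add]
    exact extDeriv_add (inChart_differentiableAt α z hz) (inChart_differentiableAt η z hz)
  map_smul' c α := by
    refine Subtype.ext (funext fun z => ?_)
    change extDeriv (inChart (c • α.1) z) _ = _
    rw [inChart_smul]
    exact extDeriv_smul c _

end Forms

/-- A smooth pseudo-Riemannian metric on `M`, of arbitrary signature: a smooth field of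
nondegenerate symmetric bilinear forms on the tangent spaces. -/
structure Metric (n : ℕ) (M : Type*) [TopologicalSpace M] [ChartedSpace (E n) M]
    [IsManifold (𝓡 n) ∞ M] where
  val : (z : M) → LinearMap.BilinForm ℝ (TangentSpace (𝓡 n) z)
  symm : ∀ z, (val z).IsSymm
  nondegenerate : ∀ z, (val z).Nondegenerate
  smooth : ∀ (x : M) (i j : Fin n),
    ContDiffOn ℝ ∞ (fun y => val ((chart x).symm y) (frame x y (e i)) (frame x y (e j)))
      (chart x).target

namespace Metric

variable {n : ℕ} {M : Type*} [TopologicalSpace M] [ChartedSpace (E n) M]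
  [IsManifold (𝓡 n) ∞ M] (g : Metric n M)

/-- The components `g_{ij}` in the chart at `x`, as functions of the coordinates. -/
def coeff (x : M) (y : E n) : Matrix (Fin n) (Fin n) ℝ :=
  Matrix.of fun i j => g.val ((chart x).symm y) (frame x y (e i)) (frame x y (e j))

/-- The components `g_{ij}` at `z`, in the coordinates of the chart at `z`. -/
def gram (z : M) : Matrix (Fin n) (Fin n) ℝ := g.coeff z (chart (n := n) z z)

/-- The partial derivative `∂ₐ f` of a function of the coordinates. -/
def pd (a : Fin n) (f : E n → ℝ) (y : E n) : ℝ := fderiv ℝ f y (e a)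

/-- The Christoffel symbols `Γ^c_{ab}` in the chart at `x`. -/
def christoffel (x : M) (c a b : Fin n) (y : E n) : ℝ :=
  (1 / 2) * ∑ s, (g.coeff x y)⁻¹ c s *
    (pd a (fun y' => g.coeff x y' b s) y + pd b (fun y' => g.coeff x y' a s) y
      - pd s (fun y' => g.coeff x y' a b) y)

/-- The components of the curvature tensor at `z` in the chart at `z`:
`riemann z a b c s` is `R_{ab}{}^c{}_s`, where `[∇_a, ∇_b] v^c = R_{ab}{}^c{}_s v^s`. -/
def riemann (z : M) (a b c s : Fin n) : ℝ :=
  pd a (g.christoffel z c b s) (chart (n := n) z z)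
    - pd b (g.christoffel z c a s) (chart (n := n) z z)
    + ∑ t, (g.christoffel z c a t (chart (n := n) z z) * g.christoffel z t b s (chart (n := n) z z)
      - g.christoffel z c b t (chart (n := n) z z) * g.christoffel z t a s (chart (n := n) z z))

/-- The components of the Ricci tensor at `z` in the chart at `z`: `Ric_{bs} = R_{ab}{}^a{}_s`. -/
def ricci (z : M) (b s : Fin n) : ℝ := ∑ a, g.riemann z a b a s

/-- The trace `g^{ij} T_{ij}` at `z` of a bilinear form with components `T_{ij}`. -/
def trace (z : M) (T : Fin n → Fin n → ℝ) : ℝ := ∑ i, ∑ j, (g.gram z)⁻¹ i j * T i j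

/-- The scalar curvature. -/
def scalarCurvature (z : M) : ℝ := g.trace z (g.ricci z)

/-- The components of the Schouten tensor `P`, where `Ric = (n - 2) P + J g`, `J = tr_g P`. -/
def schouten (z : M) (i j : Fin n) : ℝ :=
  (1 / ((n : ℝ) - 2)) *
    (g.ricci z i j - g.scalarCurvature z / (2 * ((n : ℝ) - 1)) * g.gram z i j)

/-- `J`, the trace of the Schouten tensor. -/
def schoutenTrace (z : M) : ℝ := g.trace z (g.schouten z)

/-- `g` is Einstein: `Ric = c g` for a constant `c`. -/
def IsEinstein : Prop := ∃ c : ℝ, ∀ (z : M) (i j : Fin n), g.ricci z i j = c * g.gram z i j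

/-- `g` is Ricci-flat. -/
def IsRicciFlat : Prop := ∀ (z : M) (i j : Fin n), g.ricci z i j = 0

/-- The inner product of `k`-forms at `z`:
`φ · ψ = (1/k!) g^{a₁b₁} ⋯ g^{a_k b_k} φ_{a₁…a_k} ψ_{b₁…b_k}`. -/
def formInner {k : ℕ} (z : M) (φ ψ : (TangentSpace (𝓡 n) z) [⋀^Fin k]→L[ℝ] ℝ) : ℝ :=
  (1 / (k.factorial : ℝ)) * ∑ a : Fin k → Fin n, ∑ b : Fin k → Fin n,
    (∏ i, (g.gram z)⁻¹ (a i) (b i)) * φ (fun i => (e (a i) : E n)) * ψ (fun i => (e (b i) : E n))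

/-- The pseudo-Riemannian volume measure (no orientation is used).  In each chart it is
`√|det g_{ij}| dy`; as these local measures agree on overlaps, it is their supremum. -/
def volume [MeasurableSpace M] : MeasureTheory.Measure M :=
  ⨆ x : M, MeasureTheory.Measure.map (chart (n := n) x).symm
    ((MeasureTheory.volume.restrict (chart (n := n) x).target).withDensity
      fun y => ENNReal.ofReal (Real.sqrt |(g.coeff x y).det|))

variable [MeasurableSpace M]

/-- The global pairing `⟨φ, ψ⟩ = ∫_M φ · ψ dμ_g`. -/
def pairing {k : ℕ} (φ ψ : Form n M k) : ℝ := ∫ z, g.formInner z (φ.1 z) (ψ.1 z) ∂g.volume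

open Classical in
/-- The formal adjoint of `d : ℰᵏ → ℰᵏ⁺¹` (`M` compact): the unique linear operator with
`⟨dφ, ψ⟩ = ⟨φ, D ψ⟩` for all smooth `φ`, `ψ`.  It exists on every compact `M` (it is the
differential operator `ψ ↦ -∇^a ψ_{a…}`), so that the second branch is never taken there. -/
def adjointD (k : ℕ) : Form n M (k + 1) →ₗ[ℝ] Form n M k :=
  if h : ∃ D : Form n M (k + 1) →ₗ[ℝ] Form n M k,
      ∀ φ ψ, g.pairing (d n M k φ) ψ = g.pairing φ (D ψ)
  then h.choose else 0

/-- The codifferential `δ` on `k`-forms, the formal adjoint of `d`.  As there are no `(-1)`-forms,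
it is zero on functions (where the target is written as `Form n M 0`). -/
def codiff : (k : ℕ) → Form n M k →ₗ[ℝ] Form n M (k - 1)
  | 0 => 0
  | k + 1 => g.adjointD k

/-- The operator `d δ` on `k`-forms; zero for `k = 0`. -/
def dDelta : (k : ℕ) → Module.End ℝ (Form n M k)
  | 0 => 0
  | k + 1 => d n M k ∘ₗ g.codiff (k + 1)

variable (n) in
/-- The scalar `2i(n-2k-i+1)/n`. -/
def factor (k i : ℕ) : ℝ := 2 * (i : ℝ) * ((n : ℝ) - 2 * k - i + 1) / n

variable (n) in
/-- The scalar `sᵏ = ∏_{i=1}^{(n-2k)/2} 2i(n-2k-i+1)/n`. -/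
def sConst (k : ℕ) : ℝ := ∏ i ∈ Finset.Icc 1 ((n - 2 * k) / 2), factor n k i

/-- The Q-operator `Q_k = ∏_{i=1}^{(n-2k)/2} (dδ + (2i(n-2k-i+1)/n) J)` of an Einstein metric of
even dimension `n`, where `J` is the (constant) trace of the Schouten tensor.  The factors
commute; the empty product is the identity. -/
def Q (J : ℝ) (k : ℕ) : Module.End ℝ (Form n M k) :=
  ((List.range ((n - 2 * k) / 2)).map fun i =>
    g.dDelta k + (factor n k (i + 1) * J) • (1 : Module.End ℝ (Form n M k))).prod

/-- The gauge companion operator `G_k = δ Q_k`. -/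
def G (J : ℝ) (k : ℕ) : Form n M k →ₗ[ℝ] Form n M (k - 1) := g.codiff k ∘ₗ g.Q J k

variable (n M) in
/-- The space `𝒞ᵏ` of closed `k`-forms. -/
def closedForms (k : ℕ) : Submodule ℝ (Form n M k) := LinearMap.ker (d n M k)

/-- The conformal harmonics `ℋᵏ_G`: the null space of `G_k` on closed `k`-forms. -/
def conformalHarmonics (J : ℝ) (k : ℕ) : Submodule ℝ (Form n M k) :=
  closedForms n M k ⊓ LinearMap.ker (g.G J k)

/-- `ℋᵏ_σ = ker d ∩ ker δ`. -/
def harmonics (k : ℕ) : Submodule ℝ (Form n M k) :=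
  closedForms n M k ⊓ LinearMap.ker (g.codiff k)

/-- The space of `f ∈ ℰᵏ` with `d δ f = lam f`. -/
def eigenforms (k : ℕ) (lam : ℝ) : Submodule ℝ (Form n M k) :=
  LinearMap.ker (g.dDelta k - lam • (1 : Module.End ℝ (Form n M k)))

/-- The form `Θ̃(u, w) = ⟨u, Q_k w⟩` on the conformal harmonics. -/
def thetaTilde (J : ℝ) (k : ℕ) (u w : g.conformalHarmonics J k) : ℝ :=
  g.pairing (u : Form n M k) (g.Q J k w)

end Metric

end PseudoRiem

end

/-! Write `A = dδ` on `k`-forms and `m = (n - 2k)/2`. For an Einstein metric `Ric = c g` one finds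
`J = nc/(2(n-1))`, nonzero because `c` is. The operator `Q_k` is a polynomial in `A` whose roots are
nonzero and pairwise distinct (`factor_pos`, `factor_injOn`). What remains is the algebra of `A` and
a single integration by parts; neither ellipticity nor definiteness of the metric plays a role,
which is why any signature is allowed.

Distinct roots give coprime factors, so `ker Q_k` is the sum of the eigenspaces (`ker_Q`). Nonzero
roots put `ker Q_k` inside the range of `A` (`ker_Q_le_range`), so its elements are closed. If `δu =
0`, then `Au = 0` and `Q_k u = sᵏ Jᵐ u`. If `u` is a conformal harmonic, then `Q_k u` is closed,
because `A` has closed values, and coclosed, because `G_k u = 0`. Hence `π = (sᵏ Jᵐ)⁻¹ Q_k` is a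
projection onto the harmonics with kernel `ker Q_k`. Finally `u - πu = dδv` for some `v`, and `⟨dδv,
πw⟩ = ⟨δv, δπw⟩ = 0`, so `⟨u, Q_k w⟩ = sᵏ Jᵐ ⟨u, πw⟩ = sᵏ Jᵐ ⟨πu, πw⟩`.

The analytic part is that `δ`, defined by choosing an adjoint of `d`, really is one: an adjoint must
be shown to exist (`exists_adjoint`). In a chart with density `w = √|det g|` it is `-w⁻¹ ∂_c (w
ψ^{c…})` with the remaining indices lowered, because `w (dφ · ψ - φ · δψ)` is a divergence
(`sum_fderiv_dotForm_contract`). A partition of unity makes it global. This needs the inner product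
of forms to be chart independent (`formInner_eq_matInner`), and the volume, a supremum of chart
measures, to agree with the chart measure on each chart domain (`volume_restrict_source`). -/

noncomputable section

namespace PseudoRiem

/-! ### Alternating forms on `ℝⁿ` in components -/

section Components

variable {n k : ℕ}

/-- The endomorphism of `ℝⁿ` with a given matrix. -/
def matCLM (B : Matrix (Fin n) (Fin n) ℝ) : E n →L[ℝ] E n := Matrix.toEuclideanCLM (𝕜 := ℝ) B

/-- The matrix of an endomorphism of `ℝⁿ`. -/
def matOf (T : E n →L[ℝ] E n) : Matrix (Fin n) (Fin n) ℝ :=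
  (Matrix.toEuclideanCLM (n := Fin n) (𝕜 := ℝ)).symm T

lemma matCLM_matOf (T : E n →L[ℝ] E n) : matCLM (matOf T) = T :=
  (Matrix.toEuclideanCLM (n := Fin n) (𝕜 := ℝ)).apply_symm_apply T

lemma matCLM_mul (A B : Matrix (Fin n) (Fin n) ℝ) :
    matCLM (A * B) = (matCLM A).comp (matCLM B) := map_mul _ A B

lemma matCLM_one : matCLM (1 : Matrix (Fin n) (Fin n) ℝ) = ContinuousLinearMap.id ℝ (E n) :=
  map_one _

lemma e_apply (i j : Fin n) : (e i : E n) j = if j = i then 1 else 0 := by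
  simp [e]

lemma eq_sum_e (v : E n) : v = ∑ i, v i • e i := by
  ext j
  simp [e_apply]

lemma matCLM_e (B : Matrix (Fin n) (Fin n) ℝ) (j : Fin n) :
    matCLM B (e j) = ∑ i, B i j • e i := by
  rw [eq_sum_e (matCLM B (e j))]
  simp [matCLM, e, Matrix.ofLp_toEuclideanCLM]

lemma det_matCLM (B : Matrix (Fin n) (Fin n) ℝ) : (matCLM B).det = B.det := by
  have : ((matCLM B : E n →L[ℝ] E n) : E n →ₗ[ℝ] E n) =
      Matrix.toLin (EuclideanSpace.basisFun (Fin n) ℝ).toBasis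
        (EuclideanSpace.basisFun (Fin n) ℝ).toBasis B := by
    refine (EuclideanSpace.basisFun (Fin n) ℝ).toBasis.ext fun j => ?_
    rw [Matrix.toLin_self]
    simpa [e] using matCLM_e B j
  rw [ContinuousLinearMap.det, this, LinearMap.det_toLin]

lemma det_matOf (T : E n →L[ℝ] E n) : (matOf T).det = T.det := by
  rw [← det_matCLM, matCLM_matOf]

/-- The sum of the products of the components of two alternating forms. -/
def dotForm (φ ψ : (E n) [⋀^Fin k]→L[ℝ] ℝ) : ℝ :=
  ∑ a : Fin k → Fin n, φ (fun i => e (a i)) * ψ (fun i => e (a i))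

lemma comp_matCLM_e (φ : (E n) [⋀^Fin k]→L[ℝ] ℝ) (B : Matrix (Fin n) (Fin n) ℝ)
    (a : Fin k → Fin n) :
    φ.compContinuousLinearMap (matCLM B) (fun i => e (a i)) =
      ∑ b : Fin k → Fin n, (∏ i, B (b i) (a i)) * φ (fun i => e (b i)) := by
  have h := φ.toMultilinearMap.map_sum (fun i (j : Fin n) => B j (a i) • (e j : E n))
  have h' : ∀ b : Fin k → Fin n, φ.toMultilinearMap (fun i => B (b i) (a i) • (e (b i) : E n)) =
      (∏ i, B (b i) (a i)) * φ (fun i => e (b i)) := fun b => by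
    rw [φ.toMultilinearMap.map_smul_univ]; rfl
  simp_rw [h'] at h
  rw [← h]
  change φ (fun i => matCLM B (e (a i))) = φ _
  simp_rw [matCLM_e]

/-- Expanding both sides in components gives the same double sum in the two orders: pullbacks by `B`
and by its transpose are adjoint. -/
lemma dotForm_comp_left (φ ψ : (E n) [⋀^Fin k]→L[ℝ] ℝ) (B : Matrix (Fin n) (Fin n) ℝ) :
    dotForm (φ.compContinuousLinearMap (matCLM B)) ψ =
      dotForm φ (ψ.compContinuousLinearMap (matCLM B.transpose)) := by
  simp only [dotForm, comp_matCLM_e, Finset.sum_mul, Finset.mul_sum, Matrix.transpose_apply]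
  rw [Finset.sum_comm]
  refine Finset.sum_congr rfl fun a _ => Finset.sum_congr rfl fun b _ => ?_
  ring

/-- The inner product of alternating forms on `ℝⁿ` given by a bilinear form with matrix `A`. -/
def matInner (A : Matrix (Fin n) (Fin n) ℝ) (φ ψ : (E n) [⋀^Fin k]→L[ℝ] ℝ) : ℝ :=
  (1 / (k.factorial : ℝ)) * ∑ a : Fin k → Fin n, ∑ b : Fin k → Fin n,
    (∏ i, A⁻¹ (a i) (b i)) * φ (fun i => e (a i)) * ψ (fun i => e (b i))

/-- Raising all indices of `ψ` is a pullback by a matrix, so statements about the metric pairing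
reduce to composition of matrices. -/
lemma matInner_eq_dotForm (A : Matrix (Fin n) (Fin n) ℝ) (φ ψ : (E n) [⋀^Fin k]→L[ℝ] ℝ) :
    matInner A φ ψ = (1 / (k.factorial : ℝ)) *
      dotForm φ (ψ.compContinuousLinearMap (matCLM A⁻¹.transpose)) := by
  simp only [matInner, dotForm, comp_matCLM_e, Finset.mul_sum, Matrix.transpose_apply]
  refine Finset.sum_congr rfl fun a _ => Finset.sum_congr rfl fun b _ => ?_
  ring

lemma comp_matCLM_comp_matCLM (φ : (E n) [⋀^Fin k]→L[ℝ] ℝ) (A B : Matrix (Fin n) (Fin n) ℝ) :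
    (φ.compContinuousLinearMap (matCLM A)).compContinuousLinearMap (matCLM B) =
      φ.compContinuousLinearMap (matCLM (A * B)) := by
  rw [matCLM_mul]
  ext v
  simp [Function.comp_def]

/-- Invariance under a change of basis: after raising indices, the factors `T` and `T⁻¹` cancel. -/
lemma matInner_comp (A T : Matrix (Fin n) (Fin n) ℝ) (hT : T.det ≠ 0)
    (φ ψ : (E n) [⋀^Fin k]→L[ℝ] ℝ) :
    matInner (T.transpose * A * T) (φ.compContinuousLinearMap (matCLM T))
      (ψ.compContinuousLinearMap (matCLM T)) = matInner A φ ψ := by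
  have h1 : IsUnit T.det := isUnit_iff_ne_zero.2 hT
  have h2 : T * ((T.transpose * A * T)⁻¹.transpose * T.transpose) = A⁻¹.transpose := by
    have h3 : IsUnit T.transpose.det := by rwa [Matrix.det_transpose]
    rw [← Matrix.transpose_mul, Matrix.mul_inv_rev, Matrix.mul_inv_rev,
      Matrix.mul_nonsing_inv_cancel_left _ _ h1, Matrix.transpose_mul, ← mul_assoc,
      ← Matrix.transpose_nonsing_inv, Matrix.transpose_transpose,
      Matrix.mul_nonsing_inv _ h1, one_mul]
  rw [matInner_eq_dotForm, matInner_eq_dotForm, dotForm_comp_left, comp_matCLM_comp_matCLM,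
    comp_matCLM_comp_matCLM, h2]

end Components

/-! ### Frames and changes of chart -/

section Frames

variable {n : ℕ} {M : Type*} [TopologicalSpace M] [ChartedSpace (E n) M]
  [IsManifold (𝓡 n) ∞ M] {k : ℕ}

lemma coordChange_frame (x : M) {y : E n} (hy : y ∈ (chart x).target) (v : E n) :
    tangentCoordChange (𝓡 n) ((chart x).symm y) x ((chart x).symm y) (frame x y v) = v := by
  have h1 : (chart x).symm y ∈ (extChartAt (𝓡 n) x).source := (chart x).map_target hy
  exact (tangentCoordChange_comp ⟨⟨h1, mem_extChartAt_source _⟩, h1⟩).trans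
    (tangentCoordChange_self h1)

lemma frame_coordChange (x : M) {y : E n} (hy : y ∈ (chart x).target) (v : E n) :
    frame x y (tangentCoordChange (𝓡 n) ((chart x).symm y) x ((chart x).symm y) v) = v := by
  have h1 : (chart x).symm y ∈ (extChartAt (𝓡 n) x).source := (chart x).map_target hy
  exact (tangentCoordChange_comp ⟨⟨mem_extChartAt_source _, h1⟩, mem_extChartAt_source _⟩).trans
    (tangentCoordChange_self (mem_extChartAt_source _))

/-- The derivative at `y` of the change of coordinates from the chart at `x` to that at `z`. -/
def transition (x z : M) (y : E n) : E n →L[ℝ] E n :=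
  fderiv ℝ (chart (n := n) z ∘ (chart x).symm) y

lemma transition_eq (x z : M) {y : E n} (hy : y ∈ (chart x).target) :
    transition x z y = tangentCoordChange (𝓡 n) x z ((chart x).symm y) :=
  (frame_eq_fderiv x z hy).symm

lemma frame_transition (x z : M) {y : E n} (hy : y ∈ (chart x).target)
    (hz : (chart x).symm y ∈ (chart (n := n) z).source) (v : E n) :
    tangentCoordChange (𝓡 n) z ((chart x).symm y) ((chart x).symm y) (transition x z y v) =
      frame x y v := by
  rw [transition_eq x z hy, tangentCoordChange_comp
    ⟨⟨(chart x).map_target hy, hz⟩, mem_extChartAt_source _⟩]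
  rfl

lemma det_transition_ne_zero (x z : M) {y : E n} (hy : y ∈ (chart x).target)
    (hz : (chart x).symm y ∈ (chart (n := n) z).source) : (transition x z y).det ≠ 0 := by
  have h1 : (chart x).symm y ∈ (extChartAt (𝓡 n) x).source := (chart x).map_target hy
  have h : (tangentCoordChange (𝓡 n) z x ((chart x).symm y) : E n →L[ℝ] E n).comp
      (transition x z y) = ContinuousLinearMap.id ℝ _ := by
    ext1 v
    rw [ContinuousLinearMap.comp_apply, transition_eq x z hy,
      tangentCoordChange_comp ⟨⟨h1, hz⟩, h1⟩, tangentCoordChange_self h1]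
    rfl
  intro h0
  have h2 := congrArg ContinuousLinearMap.det h
  have h3 : ∀ S T : E n →L[ℝ] E n, (S.comp T).det = S.det * T.det := fun S T => by
    simp [ContinuousLinearMap.det, LinearMap.det_comp]
  rw [h3, h0, mul_zero] at h2
  simp [ContinuousLinearMap.det] at h2

lemma inChart_transition (α : RawForm n M k) (x z : M) {y : E n} (hy : y ∈ (chart x).target)
    (hz : (chart x).symm y ∈ (chart (n := n) z).source) :
    inChart α x y = (inChart α z (chart (n := n) z ((chart x).symm y))).compContinuousLinearMap
      (transition x z y) :=
  (inChart_eventuallyEq α x z hy hz).self_of_nhds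

lemma inChart_self (α : RawForm n M k) (z : M) : inChart α z (chart (n := n) z z) = α z := by
  -- The inverse chart returns `z` only up to a propositional equality, on which the tangent space
  -- depends. Generalizing the point to `p` lets the equality be eliminated.
  have key : ∀ p, p = z → ∀ v : Fin k → E n,
      α p (fun i => tangentCoordChange (𝓡 n) z p p (v i)) = α z v := by
    rintro p rfl v
    congr 1
    funext i
    exact tangentCoordChange_self (mem_extChartAt_source _)
  ext v
  exact key _ (extChartAt_to_inv (I := 𝓡 n) z) v

end Frames

/-! ### The metric and the inner product of forms in an arbitrary chart -/

namespace Metric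

variable {n : ℕ} {M : Type*} [TopologicalSpace M] [ChartedSpace (E n) M]
  [IsManifold (𝓡 n) ∞ M] (g : Metric n M) {k : ℕ}

lemma val_frame (x : M) (y : E n) (v w : E n) :
    g.val ((chart x).symm y) (frame x y v) (frame x y w) =
      ∑ i, ∑ j, v i * g.coeff x y i j * w j := by
  conv_lhs => rw [eq_sum_e v, eq_sum_e w]
  simp only [map_sum, map_smul, LinearMap.sum_apply, LinearMap.smul_apply, smul_eq_mul, coeff,
    Matrix.of_apply, Finset.mul_sum]
  rw [Finset.sum_comm]
  refine Finset.sum_congr rfl fun a _ => Finset.sum_congr rfl fun b _ => ?_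
  ring

lemma coeff_transpose (x : M) (y : E n) : (g.coeff x y).transpose = g.coeff x y := by
  ext i j
  exact (g.symm _).eq _ _

lemma det_coeff_ne_zero (x : M) {y : E n} (hy : y ∈ (chart x).target) :
    (g.coeff x y).det ≠ 0 := by
  intro h
  obtain ⟨v, hv, h0⟩ := Matrix.exists_mulVec_eq_zero_iff.2 h
  refine hv ?_
  -- A null vector of the matrix gives a tangent vector orthogonal to the image of the frame, which
  -- is the whole tangent space.
  have h1 : ∀ w : E n, g.val ((chart x).symm y) (frame x y w) (frame x y (WithLp.toLp 2 v)) = 0 := by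
    intro w
    rw [val_frame]
    refine Finset.sum_eq_zero fun i _ => ?_
    have := congrFun h0 i
    simp only [Matrix.mulVec, dotProduct, Pi.zero_apply] at this
    simp only [mul_assoc, ← Finset.mul_sum, this, mul_zero]
  have h2 := (g.nondegenerate ((chart x).symm y)).2 (frame x y (WithLp.toLp 2 v)) fun w => by
    rw [← frame_coordChange x hy w]
    exact h1 _
  have h3 := coordChange_frame x hy (WithLp.toLp 2 v)
  rw [h2] at h3
  replace h3 := (map_zero (tangentCoordChange (𝓡 n) ((chart x).symm y) x
    ((chart x).symm y))).symm.trans h3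
  funext i
  simpa using congrArg (fun u : E n => u i) h3.symm

lemma coeff_transition (x z : M) {y : E n} (hy : y ∈ (chart x).target)
    (hz : (chart x).symm y ∈ (chart (n := n) z).source) :
    g.coeff x y = (matOf (transition x z y)).transpose *
      g.coeff z (chart (n := n) z ((chart x).symm y)) * matOf (transition x z y) := by
  have key : ∀ p, p = (chart x).symm y → ∀ v w : E n,
      g.val p (tangentCoordChange (𝓡 n) z p p (transition x z y v))
        (tangentCoordChange (𝓡 n) z p p (transition x z y w)) =
      g.val ((chart x).symm y) (frame x y v) (frame x y w) := by
    rintro p rfl v w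
    rw [frame_transition x z hy hz, frame_transition x z hy hz]
  have hT : ∀ i j, matOf (transition x z y) i j = (transition x z y (e j)) i := by
    intro i j
    conv_rhs => rw [← matCLM_matOf (transition x z y), matCLM_e]
    simp [e_apply]
  ext i j
  refine (key _ ((chart z).left_inv hz) (e i) (e j)).symm.trans ?_
  refine (g.val_frame z _ _ _).trans ?_
  simp only [Matrix.mul_apply, Matrix.transpose_apply, hT, Finset.sum_mul]
  exact Finset.sum_comm

/-- The inner product at a point is defined in the chart centred there; the transformation laws of
the metric and of the two forms move it to any chart containing the point. -/
lemma formInner_eq_matInner (α β : RawForm n M k) (x : M) {y : E n} (hy : y ∈ (chart x).target) :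
    g.formInner ((chart x).symm y) (α ((chart x).symm y)) (β ((chart x).symm y)) =
      matInner (g.coeff x y) (inChart α x y) (inChart β x y) := by
  set z := (chart x).symm y with hz
  have hzs : (chart x).symm y ∈ (chart (n := n) z).source := mem_extChartAt_source z
  have h : g.formInner z (α z) (β z) =
      matInner (g.coeff z (chart (n := n) z z)) (inChart α z (chart (n := n) z z))
        (inChart β z (chart (n := n) z z)) := by
    rw [inChart_self, inChart_self]
    rfl
  rw [h, g.coeff_transition x z hy hzs, inChart_transition α x z hy hzs,
    inChart_transition β x z hy hzs]
  have hd : (matOf (transition x z y)).det ≠ 0 := by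
    rw [det_matOf]
    exact det_transition_ne_zero x z hy hzs
  have h2 := matInner_comp (g.coeff z (chart (n := n) z z)) _ hd
    (inChart α z (chart (n := n) z z)) (inChart β z (chart (n := n) z z))
  rw [matCLM_matOf] at h2
  exact h2.symm

end Metric

/-! ### Smoothness of matrix and form valued functions -/

section Smoothness

variable {n k : ℕ}

lemma contDiffOn_matrix_det {F : Type*} [NormedAddCommGroup F] [NormedSpace ℝ F] {U : Set F}
    {m : ℕ} {A : F → Matrix (Fin m) (Fin m) ℝ}
    (hA : ∀ i j, ContDiffOn ℝ ∞ (fun y => A y i j) U) : ContDiffOn ℝ ∞ (fun y => (A y).det) U := by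
  simp only [Matrix.det_apply]
  refine ContDiffOn.sum fun σ _ => ContDiffOn.const_smul _ ?_
  exact contDiffOn_prod fun i _ => hA _ _

lemma contDiffOn_matrix_inv {F : Type*} [NormedAddCommGroup F] [NormedSpace ℝ F] {U : Set F}
    {m : ℕ} {A : F → Matrix (Fin m) (Fin m) ℝ}
    (hA : ∀ i j, ContDiffOn ℝ ∞ (fun y => A y i j) U) (h0 : ∀ y ∈ U, (A y).det ≠ 0)
    (i j : Fin m) : ContDiffOn ℝ ∞ (fun y => (A y)⁻¹ i j) U := by
  -- Cramer's rule: entries of the inverse are quotients of determinants.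
  have h : ∀ y, (A y)⁻¹ i j = ((A y).det)⁻¹ * ((A y).updateRow j (Pi.single i 1)).det := by
    intro y
    rw [Matrix.inv_def, Matrix.smul_apply, Matrix.adjugate_apply, Ring.inverse_eq_inv', smul_eq_mul]
  simp only [h]
  refine ((contDiffOn_matrix_det hA).inv h0).mul (contDiffOn_matrix_det fun a b => ?_)
  by_cases hab : a = j
  · subst hab
    simpa using contDiffOn_const
  · simpa [Matrix.updateRow_ne hab] using hA a b

lemma contDiffOn_form_apply {U : Set (E n)} {η : E n → (E n) [⋀^Fin k]→L[ℝ] ℝ}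
    (h : ContDiffOn ℝ ∞ η U) (v : Fin k → E n) : ContDiffOn ℝ ∞ (fun y => η y v) U :=
  (ContinuousAlternatingMap.apply ℝ (E n) ℝ v).contDiff.comp_contDiffOn h

lemma form_ext {φ ψ : (E n) [⋀^Fin k]→L[ℝ] ℝ}
    (h : ∀ a : Fin k → Fin n, φ (fun i => e (a i)) = ψ (fun i => e (a i))) : φ = ψ := by
  refine ContinuousAlternatingMap.toAlternatingMap_injective
    (Module.Basis.ext_alternating (EuclideanSpace.basisFun (Fin n) ℝ).toBasis fun a _ => ?_)
  simpa [e] using h a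

variable (n k) in
/-- The components of an alternating form on `ℝⁿ`. -/
def components : ((E n) [⋀^Fin k]→L[ℝ] ℝ) →ₗ[ℝ] ((Fin k → Fin n) → ℝ) where
  toFun φ a := φ fun i => e (a i)
  map_add' _ _ := rfl
  map_smul' _ _ := rfl

lemma components_injective : Function.Injective (components n k) := fun _ _ h =>
  form_ext fun a => congrFun h a

instance : FiniteDimensional ℝ ((E n) [⋀^Fin k]→L[ℝ] ℝ) :=
  FiniteDimensional.of_injective (components n k) components_injective

lemma contDiffOn_form {F : Type*} [NormedAddCommGroup F] [NormedSpace ℝ F] {U : Set F}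
    {η : F → (E n) [⋀^Fin k]→L[ℝ] ℝ}
    (h : ∀ a : Fin k → Fin n, ContDiffOn ℝ ∞ (fun y => η y fun i => e (a i)) U) :
    ContDiffOn ℝ ∞ η U := by
  -- A form is recovered from its components by a linear map between finite-dimensional spaces,
  -- which is automatically continuous, hence smooth.
  obtain ⟨L, hL⟩ := (components n k).exists_leftInverse_of_injective
    (LinearMap.ker_eq_bot.2 components_injective)
  have h1 : ContDiffOn ℝ ∞ (fun y => components n k (η y)) U := contDiffOn_pi.2 h
  have h2 := (LinearMap.toContinuousLinearMap L).contDiff (n := ∞) |>.comp_contDiffOn h1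
  refine h2.congr fun y _ => ?_
  exact (LinearMap.congr_fun hL (η y)).symm

lemma contDiffOn_comp_matCLM {U : Set (E n)} {η : E n → (E n) [⋀^Fin k]→L[ℝ] ℝ}
    {B : E n → Matrix (Fin n) (Fin n) ℝ} (h : ContDiffOn ℝ ∞ η U)
    (hB : ∀ i j, ContDiffOn ℝ ∞ (fun y => B y i j) U) :
    ContDiffOn ℝ ∞ (fun y => (η y).compContinuousLinearMap (matCLM (B y))) U := by
  refine contDiffOn_form fun a => ?_
  simp only [comp_matCLM_e]
  exact ContDiffOn.sum fun b _ =>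
    (contDiffOn_prod fun i _ => hB _ _).mul (contDiffOn_form_apply h _)

lemma contDiffOn_matInner {U : Set (E n)} {A : E n → Matrix (Fin n) (Fin n) ℝ}
    (hA : ∀ i j, ContDiffOn ℝ ∞ (fun y => A y i j) U) (h0 : ∀ y ∈ U, (A y).det ≠ 0)
    {φ ψ : E n → (E n) [⋀^Fin k]→L[ℝ] ℝ} (hφ : ContDiffOn ℝ ∞ φ U) (hψ : ContDiffOn ℝ ∞ ψ U) :
    ContDiffOn ℝ ∞ (fun y => matInner (A y) (φ y) (ψ y)) U := by
  refine contDiffOn_const.mul (ContDiffOn.sum fun a _ => ContDiffOn.sum fun b _ => ?_)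
  exact ((contDiffOn_prod fun i _ => contDiffOn_matrix_inv hA h0 _ _).mul
    (contDiffOn_form_apply hφ _)).mul (contDiffOn_form_apply hψ _)

end Smoothness

/-! ### Measurability of inverse charts -/

section Charts

variable {n : ℕ} {M : Type*} [TopologicalSpace M] [ChartedSpace (E n) M] [MeasurableSpace M]
  [BorelSpace M]

lemma aemeasurable_chart_symm (x : M) : AEMeasurable (chart (n := n) x).symm
    (MeasureTheory.volume.restrict (chart (n := n) x).target) :=
  (continuousOn_extChartAt_symm (I := 𝓡 n) x).aemeasurable
    (isOpen_extChartAt_target (I := 𝓡 n) x).measurableSet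

lemma measurableSet_chart_symm_preimage (x : M) {A : Set M} (hA : MeasurableSet A) :
    MeasurableSet ((chart x).symm ⁻¹' A ∩ (chart (n := n) x).target) := by
  have hc := continuousOn_iff_continuous_domRestrict.1 (continuousOn_extChartAt_symm (I := 𝓡 n) x)
  have h := (isOpen_extChartAt_target (I := 𝓡 n) x).measurableSet.subtype_image (hc.measurable hA)
  convert h using 1
  ext y
  simp [chart, and_comm]

end Charts

/-! ### The volume measure and the global pairing -/

namespace Metric

variable {n : ℕ} {M : Type*} [TopologicalSpace M] [ChartedSpace (E n) M]
  [IsManifold (𝓡 n) ∞ M] (g : Metric n M) {k : ℕ}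

/-- The density `√|det g_{ij}|` in the chart at `x`. -/
def density (x : M) (y : E n) : ℝ := Real.sqrt |(g.coeff x y).det|

lemma density_pos (x : M) {y : E n} (hy : y ∈ (chart x).target) : 0 < g.density x y :=
  Real.sqrt_pos.2 (abs_pos.2 (g.det_coeff_ne_zero x hy))

lemma contDiffOn_coeff (x : M) (i j : Fin n) :
    ContDiffOn ℝ ∞ (fun y => g.coeff x y i j) (chart x).target :=
  g.smooth x i j

lemma contDiffOn_density (x : M) : ContDiffOn ℝ ∞ (g.density x) (chart x).target := by
  intro y hy
  have h0 := g.det_coeff_ne_zero x hy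
  have h1 := contDiffOn_matrix_det (g.contDiffOn_coeff x) y hy
  have h2 : ContDiffWithinAt ℝ ∞ (fun y => |(g.coeff x y).det|) (chart x).target y :=
    ContDiffAt.comp_contDiffWithinAt (g := fun t : ℝ => |t|) y (contDiffAt_abs h0) h1
  exact h2.sqrt (abs_ne_zero.2 h0)

/-- The determinant of the metric picks up the square of the Jacobian, so its root picks up the
absolute value; hence no orientation is needed. -/
lemma density_transition (x z : M) {y : E n} (hy : y ∈ (chart x).target)
    (hz : (chart x).symm y ∈ (chart (n := n) z).source) :
    g.density x y =
      |(transition x z y).det| * g.density z (chart (n := n) z ((chart x).symm y)) := by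
  rw [density, density, g.coeff_transition x z hy hz, Matrix.det_mul, Matrix.det_mul,
    Matrix.det_transpose, det_matOf, mul_right_comm, abs_mul, abs_mul_self,
    Real.sqrt_mul (mul_self_nonneg _), Real.sqrt_mul_self_eq_abs]

lemma formInner_add_left (z : M) (φ φ' ψ : (TangentSpace (𝓡 n) z) [⋀^Fin k]→L[ℝ] ℝ) :
    g.formInner z (φ + φ') ψ = g.formInner z φ ψ + g.formInner z φ' ψ := by
  simp only [formInner, ← mul_add, ← Finset.sum_add_distrib]
  congr 1
  refine Finset.sum_congr rfl fun a _ => Finset.sum_congr rfl fun b _ => ?_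
  change _ * (φ _ + φ' _) * _ = _
  ring

lemma formInner_add_right (z : M) (φ ψ ψ' : (TangentSpace (𝓡 n) z) [⋀^Fin k]→L[ℝ] ℝ) :
    g.formInner z φ (ψ + ψ') = g.formInner z φ ψ + g.formInner z φ ψ' := by
  simp only [formInner, ← mul_add, ← Finset.sum_add_distrib]
  congr 1

lemma formInner_smul_right (z : M) (c : ℝ) (φ ψ : (TangentSpace (𝓡 n) z) [⋀^Fin k]→L[ℝ] ℝ) :
    g.formInner z φ (c • ψ) = c * g.formInner z φ ψ := by
  simp only [formInner, Finset.mul_sum]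
  refine Finset.sum_congr rfl fun a _ => Finset.sum_congr rfl fun b _ => ?_
  change _ * (_ * (c * ψ _)) = _
  ring

lemma continuous_formInner (α β : Form n M k) :
    Continuous fun z => g.formInner z (α.1 z) (β.1 z) := by
  rw [continuous_iff_continuousAt]
  intro x
  have hT := isOpen_extChartAt_target (I := 𝓡 n) x
  have hx : chart (n := n) x x ∈ (chart (n := n) x).target := mem_extChartAt_target x
  have h1 : ContinuousAt (fun y => matInner (g.coeff x y) (inChart α.1 x y) (inChart β.1 x y))
      (chart (n := n) x x) :=
    (contDiffOn_matInner (g.contDiffOn_coeff x) (fun y hy => g.det_coeff_ne_zero x hy) (α.2 x)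
      (β.2 x)).continuousOn.continuousAt (hT.mem_nhds hx)
  refine (h1.comp (continuousAt_extChartAt (I := 𝓡 n) x)).congr ?_
  filter_upwards [extChartAt_source_mem_nhds (I := 𝓡 n) x] with z hz
  have h2 := g.formInner_eq_matInner α.1 β.1 x ((chart (n := n) x).map_source hz)
  have h3 : (chart x).symm (chart (n := n) x z) = z := (chart x).left_inv hz
  have key : ∀ p, p = z → g.formInner p (α.1 p) (β.1 p) = g.formInner z (α.1 z) (β.1 z) := by
    rintro p rfl; rfl
  exact h2.symm.trans (key _ h3)

variable [MeasurableSpace M]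

/-- The volume measure of the chart at `x`. -/
def localVolume (x : M) : MeasureTheory.Measure M :=
  MeasureTheory.Measure.map (chart (n := n) x).symm
    ((MeasureTheory.volume.restrict (chart (n := n) x).target).withDensity
      fun y => ENNReal.ofReal (g.density x y))

lemma volume_eq : g.volume = ⨆ x, g.localVolume x := rfl

lemma pairing_smul_right (c : ℝ) (φ ψ : Form n M k) :
    g.pairing φ (c • ψ) = c * g.pairing φ ψ := by
  rw [pairing, pairing, ← MeasureTheory.integral_const_mul]
  exact MeasureTheory.integral_congr_ae (.of_forall fun z => g.formInner_smul_right z c _ _)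

variable [BorelSpace M]

lemma localVolume_apply (x : M) {A : Set M} (hA : MeasurableSet A) :
    g.localVolume x A = ∫⁻ y in (chart x).symm ⁻¹' A ∩ (chart (n := n) x).target,
      ENNReal.ofReal (g.density x y) := by
  have hT : MeasurableSet (chart (n := n) x).target :=
    (isOpen_extChartAt_target (I := 𝓡 n) x).measurableSet
  rw [localVolume, MeasureTheory.Measure.map_apply_of_aemeasurable
    ((aemeasurable_chart_symm x).mono_ac (MeasureTheory.withDensity_absolutelyContinuous _ _)) hA,
    MeasureTheory.withDensity_apply', MeasureTheory.Measure.restrict_restrict' hT]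

/-- Change of variables on the overlap of the two charts: the density absorbs the Jacobian, and the
image of the overlap lies in the region measured on the right. -/
lemma localVolume_inter_source_le (x x' : M) {A : Set M} (hA : MeasurableSet A) :
    g.localVolume x' (A ∩ (chart (n := n) x).source) ≤ g.localVolume x A := by
  have hS : MeasurableSet (chart (n := n) x).source :=
    (isOpen_extChartAt_source (I := 𝓡 n) x).measurableSet
  rw [localVolume_apply _ _ (hA.inter hS), localVolume_apply _ _ hA]
  set V := (chart x').symm ⁻¹' (A ∩ (chart (n := n) x).source) ∩ (chart (n := n) x').target
  have hV : MeasurableSet V := measurableSet_chart_symm_preimage x' (hA.inter hS)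
  have h1 : ∀ y ∈ V, HasFDerivWithinAt (chart (n := n) x ∘ (chart x').symm)
      (transition x' x y) V y := fun y hy =>
    ((coordChange_contDiffAt x' x hy.2 hy.1.2).differentiableAt (by simp)).hasFDerivAt.hasFDerivWithinAt
  have h2 : InjOn (chart (n := n) x ∘ (chart x').symm) V := fun y hy y' hy' h =>
    (chart x').symm.injOn hy.2 hy'.2 ((chart (n := n) x).injOn hy.1.2 hy'.1.2 h)
  calc ∫⁻ y in V, ENNReal.ofReal (g.density x' y)
      = ∫⁻ y in V, ENNReal.ofReal |(transition x' x y).det| *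
          ENNReal.ofReal (g.density x ((chart (n := n) x ∘ (chart x').symm) y)) := by
        refine MeasureTheory.setLIntegral_congr_fun hV fun y hy => ?_
        rw [← ENNReal.ofReal_mul (abs_nonneg _), g.density_transition x' x hy.2 hy.1.2]
        rfl
    _ = ∫⁻ y in (chart (n := n) x ∘ (chart x').symm) '' V, ENNReal.ofReal (g.density x y) :=
        (MeasureTheory.lintegral_image_eq_lintegral_abs_det_fderiv_mul _ hV h1 h2
          fun y => ENNReal.ofReal (g.density x y)).symm
    _ ≤ _ := by
        refine MeasureTheory.lintegral_mono_set ?_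
        rintro _ ⟨y, hy, rfl⟩
        refine ⟨?_, (chart (n := n) x).map_source hy.1.2⟩
        have : (chart x).symm (chart (n := n) x ((chart x').symm y)) = (chart x').symm y :=
          (chart x).left_inv hy.1.2
        simp only [mem_preimage, Function.comp_apply, this]
        exact hy.1.1

lemma localVolume_restrict_source (x : M) :
    (g.localVolume x).restrict (chart (n := n) x).source = g.localVolume x := by
  have hS : MeasurableSet (chart (n := n) x).source :=
    (isOpen_extChartAt_source (I := 𝓡 n) x).measurableSet
  refine MeasureTheory.Measure.restrict_eq_self_of_ae_mem ?_
  rw [MeasureTheory.ae_iff]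
  change g.localVolume x (chart (n := n) x).sourceᶜ = 0
  rw [localVolume_apply _ _ hS.compl]
  have : (chart x).symm ⁻¹' (chart (n := n) x).sourceᶜ ∩ (chart (n := n) x).target = ∅ :=
    eq_empty_of_forall_notMem fun y hy => hy.1 ((chart x).map_target hy.2)
  rw [this]
  simp

/-- On the domain of a chart, the volume measure is the volume measure of the chart. -/
lemma volume_restrict_source (x : M) :
    g.volume.restrict (chart (n := n) x).source = g.localVolume x := by
  have hS : MeasurableSet (chart (n := n) x).source :=
    (isOpen_extChartAt_source (I := 𝓡 n) x).measurableSet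
  refine le_antisymm ?_ ?_
  -- On the chart domain each local measure is bounded by the one of `x`. Off it the crude bound `⊤`
  -- suffices, since restricting to the domain kills that term.
  · have h : g.volume ≤ g.localVolume x +
        (⊤ : MeasureTheory.Measure M).restrict (chart (n := n) x).sourceᶜ := by
      rw [volume_eq]
      refine iSup_le fun x' => ?_
      rw [← MeasureTheory.Measure.restrict_add_restrict_compl (μ := g.localVolume x') hS]
      refine add_le_add (MeasureTheory.Measure.le_iff.2 fun A hA => ?_)
        (MeasureTheory.Measure.restrict_mono le_rfl le_top)
      rw [MeasureTheory.Measure.restrict_apply hA]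
      exact g.localVolume_inter_source_le x x' hA
    refine (MeasureTheory.Measure.restrict_mono le_rfl h).trans ?_
    rw [MeasureTheory.Measure.restrict_add, localVolume_restrict_source,
      MeasureTheory.Measure.restrict_restrict hS, inter_compl_self,
      MeasureTheory.Measure.restrict_empty, add_zero]
  · rw [← g.localVolume_restrict_source x]
    exact MeasureTheory.Measure.restrict_mono le_rfl (le_iSup g.localVolume x)

lemma integral_volume_of_eq_zero_off_source (x : M) {f : M → ℝ} (hf : Continuous f)
    (h0 : ∀ z ∉ (chart (n := n) x).source, f z = 0) :
    ∫ z, f z ∂g.volume = ∫ y in (chart (n := n) x).target, g.density x y * f ((chart x).symm y) := by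
  rw [← MeasureTheory.setIntegral_eq_integral_of_forall_compl_eq_zero h0, volume_restrict_source,
    localVolume, MeasureTheory.integral_map
      ((aemeasurable_chart_symm x).mono_ac (MeasureTheory.withDensity_absolutelyContinuous _ _))
      hf.aestronglyMeasurable,
    integral_withDensity_eq_integral_toReal_smul₀]
  · simp [density, ENNReal.toReal_ofReal]
  · exact ((g.contDiffOn_density x).continuousOn.aemeasurable
      (isOpen_extChartAt_target (I := 𝓡 n) x).measurableSet).ennreal_ofReal
  · exact Eventually.of_forall fun _ => ENNReal.ofReal_lt_top

instance : MeasureTheory.IsLocallyFiniteMeasure g.volume where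
  finiteAtNhds x := by
    have hT := isOpen_extChartAt_target (I := 𝓡 n) x
    have hx : chart (n := n) x x ∈ (chart (n := n) x).target := mem_extChartAt_target x
    obtain ⟨K, hK, hxK, hKT⟩ := exists_compact_subset hT hx
    have hxs : x ∈ (chart (n := n) x).source := mem_extChartAt_source x
    have hU : IsOpen ((chart (n := n) x).source ∩ chart (n := n) x ⁻¹' interior K) :=
      (continuousOn_extChartAt (I := 𝓡 n) x).isOpen_inter_preimage
        (isOpen_extChartAt_source (I := 𝓡 n) x) isOpen_interior
    refine ⟨_, hU.mem_nhds ⟨hxs, hxK⟩, ?_⟩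
    -- Near `x` the volume is the chart measure, whose density is continuous and so integrable over
    -- the compact `K`.
    rw [← MeasureTheory.Measure.restrict_eq_self g.volume inter_subset_left,
      volume_restrict_source, localVolume_apply _ _ hU.measurableSet]
    refine lt_of_le_of_lt (MeasureTheory.lintegral_mono_set (t := K) ?_) ?_
    · rintro y ⟨⟨-, hy⟩, hyt⟩
      have : chart (n := n) x ((chart x).symm y) = y := (chart x).right_inv hyt
      rw [mem_preimage, this] at hy
      exact interior_subset hy
    · have h := ((g.contDiffOn_density x).continuousOn.mono hKT).integrableOn_compact
        (μ := MeasureTheory.volume) hK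
      have h2 := h.2
      rw [MeasureTheory.hasFiniteIntegral_iff_enorm] at h2
      refine lt_of_eq_of_lt (MeasureTheory.lintegral_congr fun y => ?_) h2
      exact (Real.enorm_of_nonneg (Real.sqrt_nonneg _)).symm

variable [CompactSpace M]

lemma integrable_formInner (α β : Form n M k) :
    MeasureTheory.Integrable (fun z => g.formInner z (α.1 z) (β.1 z)) g.volume :=
  (g.continuous_formInner α β).integrable_of_hasCompactSupport
    (HasCompactSupport.of_compactSpace _)

lemma pairing_add_left (φ φ' ψ : Form n M k) :
    g.pairing (φ + φ') ψ = g.pairing φ ψ + g.pairing φ' ψ := by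
  rw [pairing, pairing, pairing, ← MeasureTheory.integral_add (g.integrable_formInner _ _)
    (g.integrable_formInner _ _)]
  exact MeasureTheory.integral_congr_ae (.of_forall fun z => g.formInner_add_left z _ _ _)

lemma pairing_add_right (φ ψ ψ' : Form n M k) :
    g.pairing φ (ψ + ψ') = g.pairing φ ψ + g.pairing φ ψ' := by
  rw [pairing, pairing, pairing, ← MeasureTheory.integral_add (g.integrable_formInner _ _)
    (g.integrable_formInner _ _)]
  exact MeasureTheory.integral_congr_ae (.of_forall fun z => g.formInner_add_right z _ _ _)

end Metric

/-! ### The divergence theorem for compactly supported functions -/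

section Divergence

variable {n : ℕ}

open MeasureTheory in
lemma integral_fderiv_apply_eq_zero {f : E n → ℝ} (hf : ContDiff ℝ ∞ f) (hc : HasCompactSupport f)
    (v : E n) : ∫ y, fderiv ℝ f y v = 0 := by
  have hd : Continuous fun y => fderiv ℝ f y v :=
    (hf.continuous_fderiv (by simp)).clm_apply continuous_const
  -- Integration by parts against the constant function `1`.
  have h := integral_bilinear_hasFDerivAt_right_eq_neg_left_of_integrable (μ := volume)
    (f := fun _ : E n => (1 : ℝ)) (f' := fun _ => 0) (g := f) (g' := fderiv ℝ f) (v := v)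
    (B := ContinuousLinearMap.mul ℝ ℝ) (by simp)
    (by simpa using hd.integrable_of_hasCompactSupport (hc.fderiv_apply ℝ v))
    (by simpa using hf.continuous.integrable_of_hasCompactSupport hc)
    (fun x _ => hasFDerivAt_const _ _)
    (fun x _ => (hf.differentiable (by simp) x).hasFDerivAt)
  simpa using h

open MeasureTheory in
/-- The integral of a derivative of a smooth function with compact support in an open set. -/
lemma setIntegral_fderiv_apply_eq_zero {U K : Set (E n)} (hU : IsOpen U) (hK : IsCompact K)
    (hKU : K ⊆ U) {f : E n → ℝ} (hf : ContDiffOn ℝ ∞ f U) (h0 : ∀ y ∈ U, y ∉ K → f y = 0)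
    (v : E n) :
    IntegrableOn (fun y => fderiv ℝ f y v) U ∧ ∫ y in U, fderiv ℝ f y v = 0 := by
  have hz : ∀ y ∉ K, U.indicator f y = 0 := fun y hy => by
    by_cases hyU : y ∈ U
    · rw [indicator_of_mem hyU, h0 y hyU hy]
    · rw [indicator_of_notMem hyU]
  have heq : ∀ y ∈ U, U.indicator f =ᶠ[𝓝 y] f := fun y hy => by
    filter_upwards [hU.mem_nhds hy] with z hz
    exact indicator_of_mem hz f
  have hzn : ∀ y ∉ K, U.indicator f =ᶠ[𝓝 y] fun _ => 0 := fun y hy => by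
    filter_upwards [hK.isClosed.isOpen_compl.mem_nhds hy] with z hz'
    exact hz z hz'
  -- The extension by zero is smooth: near points of `K` it equals `f`, and off the closed set `K`
  -- it vanishes locally.
  have hs : ContDiff ℝ ∞ (U.indicator f) := by
    rw [contDiff_iff_contDiffAt]
    intro y
    by_cases hy : y ∈ K
    · exact ((hf.contDiffAt (hU.mem_nhds (hKU hy)))).congr_of_eventuallyEq (heq y (hKU hy))
    · exact contDiffAt_const.congr_of_eventuallyEq (hzn y hy)
  have hc : HasCompactSupport (U.indicator f) := HasCompactSupport.intro hK hz
  have hfd : ∀ y ∈ U, fderiv ℝ (U.indicator f) y v = fderiv ℝ f y v := fun y hy => by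
    rw [(heq y hy).fderiv_eq]
  have hd : Continuous fun y => fderiv ℝ (U.indicator f) y v :=
    (hs.continuous_fderiv (by simp)).clm_apply continuous_const
  have hi : Integrable (fun y => fderiv ℝ (U.indicator f) y v) :=
    hd.integrable_of_hasCompactSupport (hc.fderiv_apply ℝ v)
  refine ⟨hi.integrableOn.congr_fun hfd hU.measurableSet, ?_⟩
  rw [← setIntegral_congr_fun hU.measurableSet hfd,
    setIntegral_eq_integral_of_forall_compl_eq_zero, integral_fderiv_apply_eq_zero hs hc]
  intro y hy
  rw [(hzn y fun h => hy (hKU h)).fderiv_eq]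
  simp

end Divergence

/-! ### Contraction as the transpose of alternatization -/

section Contraction

variable {n k : ℕ}

/-- The contraction of an alternating form with a vector. -/
def contract (v : E n) (χ : (E n) [⋀^Fin (k + 1)]→L[ℝ] ℝ) : (E n) [⋀^Fin k]→L[ℝ] ℝ :=
  { AlternatingMap.curryLeft χ.toAlternatingMap v with
    cont := χ.cont.comp (continuous_const.matrixVecCons continuous_id) }

/-- The contraction with a vector as a continuous linear map. -/
def contractCLM (v : E n) :
    ((E n) [⋀^Fin (k + 1)]→L[ℝ] ℝ) →L[ℝ] ((E n) [⋀^Fin k]→L[ℝ] ℝ) :=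
  LinearMap.toContinuousLinearMap
    { toFun := contract v
      map_add' := fun _ _ => rfl
      map_smul' := fun _ _ => rfl }

/-- Moving the `i`-th argument of `χ` to the front costs `(-1)^i`, which cancels the sign in the
alternatization. The `k + 1` terms therefore all coincide. -/
lemma dotForm_alternatizeUncurryFin (F : E n →L[ℝ] (E n) [⋀^Fin k]→L[ℝ] ℝ)
    (χ : (E n) [⋀^Fin (k + 1)]→L[ℝ] ℝ) :
    dotForm (ContinuousAlternatingMap.alternatizeUncurryFin F) χ =
      (k + 1) * ∑ c, dotForm (F (e c)) (contractCLM (e c) χ) := by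
  have h : ∀ i : Fin (k + 1), ∑ a : Fin (k + 1) → Fin n,
      (-1) ^ (i : ℕ) • F (e (a i)) (i.removeNth fun j => e (a j)) * χ (fun j => e (a j)) =
      ∑ c, dotForm (F (e c)) (contractCLM (e c) χ) := by
    intro i
    rw [← (Fin.insertNthEquiv (fun _ => Fin n) i).sum_comp, Fintype.sum_prod_type]
    refine Finset.sum_congr rfl fun c _ => Finset.sum_congr rfl fun b _ => ?_
    have h1 : (fun j => (e ((Fin.insertNthEquiv (fun _ => Fin n) i (c, b)) j) : E n)) =
        i.insertNth (e c) fun j => e (b j) := by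
      funext j
      refine Fin.succAboveCases i ?_ (fun l => ?_) j <;> simp
    have h2 := χ.toAlternatingMap.map_insertNth i (e c) fun j => e (b j)
    have h3 : χ (i.insertNth (e c) fun j => e (b j)) =
      (-1) ^ (i : ℕ) • contractCLM (e c) χ fun j => e (b j) := h2
    have h4 : ((-1 : ℝ) ^ (i : ℕ)) * (-1) ^ (i : ℕ) = 1 := by
      rw [← mul_pow]; simp
    rw [h1, h3]
    simp only [Fin.insertNthEquiv_apply, Fin.insertNth_apply_same, Fin.removeNth_insertNth,
      zsmul_eq_mul, Int.cast_pow, Int.cast_neg, Int.cast_one]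
    linear_combination (F (e c) (fun j => e (b j)) * contractCLM (e c) χ fun j => e (b j)) * h4
  simp only [dotForm, ContinuousAlternatingMap.alternatizeUncurryFin_apply, Finset.sum_mul]
  rw [Finset.sum_comm]
  simp only [dotForm] at h
  simp only [h, Finset.sum_const, Finset.card_univ, Fintype.card_fin, nsmul_eq_mul]
  push_cast
  ring

end Contraction

/-! ### The formal adjoint of `d` in coordinates -/

section LocalAdjoint

variable {n k : ℕ}

/-- The form with raised indices, times a density. -/
def raised (A : E n → Matrix (Fin n) (Fin n) ℝ) (w : E n → ℝ)
    (ψ : E n → (E n) [⋀^Fin k]→L[ℝ] ℝ) (y : E n) : (E n) [⋀^Fin k]→L[ℝ] ℝ :=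
  w y • (ψ y).compContinuousLinearMap (matCLM (A y)⁻¹.transpose)

/-- The formal adjoint of the exterior derivative in coordinates, for the metric with matrix `A`
and the density `w`. -/
def coordCodiff (A : E n → Matrix (Fin n) (Fin n) ℝ) (w : E n → ℝ)
    (ψ : E n → (E n) [⋀^Fin (k + 1)]→L[ℝ] ℝ) (y : E n) : (E n) [⋀^Fin k]→L[ℝ] ℝ :=
  ((-(w y)⁻¹) • ∑ c, contractCLM (e c) (fderiv ℝ (raised A w ψ) y (e c))).compContinuousLinearMap
    (matCLM (A y).transpose)

variable {A : E n → Matrix (Fin n) (Fin n) ℝ} {w : E n → ℝ} {U : Set (E n)}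

lemma contDiffOn_raised (hA : ∀ i j, ContDiffOn ℝ ∞ (fun y => A y i j) U)
    (h0 : ∀ y ∈ U, (A y).det ≠ 0) (hw : ContDiffOn ℝ ∞ w U)
    {ψ : E n → (E n) [⋀^Fin k]→L[ℝ] ℝ} (hψ : ContDiffOn ℝ ∞ ψ U) :
    ContDiffOn ℝ ∞ (raised A w ψ) U :=
  hw.smul (contDiffOn_comp_matCLM hψ fun _ _ => contDiffOn_matrix_inv hA h0 _ _)

lemma contDiffOn_coordCodiff (hU : IsOpen U) (hA : ∀ i j, ContDiffOn ℝ ∞ (fun y => A y i j) U)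
    (h0 : ∀ y ∈ U, (A y).det ≠ 0) (hw : ContDiffOn ℝ ∞ w U) (hw0 : ∀ y ∈ U, w y ≠ 0)
    {ψ : E n → (E n) [⋀^Fin (k + 1)]→L[ℝ] ℝ} (hψ : ContDiffOn ℝ ∞ ψ U) :
    ContDiffOn ℝ ∞ (coordCodiff A w ψ) U := by
  refine contDiffOn_comp_matCLM (ContDiffOn.smul (hw.inv hw0).neg (ContDiffOn.sum fun c _ => ?_))
    fun i j => hA j i
  refine (contractCLM (e c)).contDiff.comp_contDiffOn ?_
  exact ((contDiffOn_raised hA h0 hw hψ).fderiv_of_isOpen hU (m := ∞) le_rfl).clm_apply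
    contDiffOn_const

lemma dotForm_add_right (φ χ χ' : (E n) [⋀^Fin k]→L[ℝ] ℝ) :
    dotForm φ (χ + χ') = dotForm φ χ + dotForm φ χ' := by
  simp only [dotForm, ← Finset.sum_add_distrib, ← mul_add]
  rfl

lemma dotForm_smul_right (c : ℝ) (φ χ : (E n) [⋀^Fin k]→L[ℝ] ℝ) :
    dotForm φ (c • χ) = c * dotForm φ χ := by
  simp only [dotForm, Finset.mul_sum]
  refine Finset.sum_congr rfl fun a _ => ?_
  change _ * (c * χ _) = _
  ring

lemma dotForm_sum_right {ι : Type*} (s : Finset ι) (φ : (E n) [⋀^Fin k]→L[ℝ] ℝ)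
    (χ : ι → (E n) [⋀^Fin k]→L[ℝ] ℝ) :
    dotForm φ (∑ c ∈ s, χ c) = ∑ c ∈ s, dotForm φ (χ c) := by
  classical
  induction s using Finset.induction_on with
  | empty => simp [dotForm]
  | insert a s ha ih => rw [Finset.sum_insert ha, Finset.sum_insert ha, dotForm_add_right, ih]

lemma fderiv_dotForm {φ χ : E n → (E n) [⋀^Fin k]→L[ℝ] ℝ} {y : E n}
    (hφ : DifferentiableAt ℝ φ y) (hχ : DifferentiableAt ℝ χ y) (v : E n) :
    fderiv ℝ (fun y => dotForm (φ y) (χ y)) y v =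
      dotForm (fderiv ℝ φ y v) (χ y) + dotForm (φ y) (fderiv ℝ χ y v) := by
  have h1 : ∀ {φ : E n → (E n) [⋀^Fin k]→L[ℝ] ℝ}, DifferentiableAt ℝ φ y → ∀ u,
      DifferentiableAt ℝ (fun y => φ y u) y := fun h u =>
    (ContinuousAlternatingMap.apply ℝ (E n) ℝ u).differentiableAt.comp y h
  simp only [dotForm]
  rw [fderiv_fun_sum fun a _ => (h1 hφ _).fun_mul (h1 hχ _), sum_apply,
    ← Finset.sum_add_distrib]
  refine Finset.sum_congr rfl fun a _ => ?_
  rw [fderiv_fun_mul (h1 hφ _) (h1 hχ _)]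
  simp only [_root_.add_apply, _root_.smul_apply, smul_eq_mul,
    fderiv_continuousAlternatingMap_apply_const_apply hφ,
    fderiv_continuousAlternatingMap_apply_const_apply hχ]
  ring

/-- The divergence identity behind the adjointness of `d` and its formal adjoint. -/
lemma sum_fderiv_dotForm_contract (hU : IsOpen U)
    (hA : ∀ i j, ContDiffOn ℝ ∞ (fun y => A y i j) U)
    (h0 : ∀ y ∈ U, (A y).det ≠ 0) (hw : ContDiffOn ℝ ∞ w U) (hw0 : ∀ y ∈ U, w y ≠ 0)
    {φ : E n → (E n) [⋀^Fin k]→L[ℝ] ℝ} {ψ : E n → (E n) [⋀^Fin (k + 1)]→L[ℝ] ℝ}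
    (hφ : ContDiffOn ℝ ∞ φ U) (hψ : ContDiffOn ℝ ∞ ψ U) {y : E n} (hy : y ∈ U) :
    ∑ c, fderiv ℝ (fun y => dotForm (φ y) (contractCLM (e c) (raised A w ψ y))) y (e c) =
      k.factorial * (w y * (matInner (A y) (extDeriv φ y) (ψ y) -
        matInner (A y) (φ y) (coordCodiff A w ψ y))) := by
  have hφ' : DifferentiableAt ℝ φ y := (hφ.contDiffAt (hU.mem_nhds hy)).differentiableAt (by simp)
  have hr : DifferentiableAt ℝ (raised A w ψ) y :=
    ((contDiffOn_raised hA h0 hw hψ).contDiffAt (hU.mem_nhds hy)).differentiableAt (by simp)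
  have hk : (k.factorial : ℝ) ≠ 0 := Nat.cast_ne_zero.2 k.factorial_ne_zero
  have hk1 : (k : ℝ) + 1 ≠ 0 := by positivity
  have h1 : ∀ c, fderiv ℝ (fun y => dotForm (φ y) (contractCLM (e c) (raised A w ψ y))) y (e c) =
      dotForm (fderiv ℝ φ y (e c)) (contractCLM (e c) (raised A w ψ y)) +
        dotForm (φ y) (contractCLM (e c) (fderiv ℝ (raised A w ψ) y (e c))) := by
    intro c
    refine (fderiv_dotForm (χ := fun y => contractCLM (e c) (raised A w ψ y)) hφ'
      ((contractCLM (e c)).differentiableAt.comp y hr) (e c)).trans ?_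
    congr 2
    have := (contractCLM (k := k) (e c)).hasFDerivAt.comp y hr.hasFDerivAt
    exact congrArg (fun L => L (e c)) this.fderiv
  have h2 : (A y)⁻¹.transpose = (A y).transpose⁻¹ := Matrix.transpose_nonsing_inv _
  have h3 : IsUnit (A y).transpose.det := by
    rw [Matrix.det_transpose]
    exact isUnit_iff_ne_zero.2 (h0 y hy)
  have h4 := dotForm_alternatizeUncurryFin (fderiv ℝ φ y) (raised A w ψ y)
  -- In the last inner product the lowering in `coordCodiff` cancels against the raising in
  -- `matInner`, leaving the plain component pairing.
  rw [Finset.sum_congr rfl fun c _ => h1 c, Finset.sum_add_distrib, ← dotForm_sum_right,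
    matInner_eq_dotForm, matInner_eq_dotForm, coordCodiff, comp_matCLM_comp_matCLM, h2,
    Matrix.mul_nonsing_inv _ h3, matCLM_one]
  have h5 : ∀ χ : (E n) [⋀^Fin k]→L[ℝ] ℝ,
      χ.compContinuousLinearMap (ContinuousLinearMap.id ℝ (E n)) = χ := fun χ => by
    ext u; rfl
  rw [h5, dotForm_smul_right, ← h2]
  rw [raised, dotForm_smul_right] at h4
  simp only [extDeriv]
  -- The factor `k + 1` from alternatization accounts for the ratio of `1/(k+1)!` and `1/k!` in the
  -- two inner products.
  have h6 : ∑ c, dotForm (fderiv ℝ φ y (e c)) (contractCLM (e c) (raised A w ψ y)) =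
      (w y * dotForm (ContinuousAlternatingMap.alternatizeUncurryFin (fderiv ℝ φ y))
        ((ψ y).compContinuousLinearMap (matCLM (A y)⁻¹.transpose))) / (k + 1) := by
    rw [h4, mul_div_cancel_left₀ _ hk1]
    rfl
  rw [h6, Nat.factorial_succ]
  have := hw0 y hy
  push_cast
  field_simp
  ring

end LocalAdjoint

/-! ### Extending forms from a chart to the manifold -/

section Extension

variable {n : ℕ} {M : Type*} [TopologicalSpace M] [ChartedSpace (E n) M]
  [IsManifold (𝓡 n) ∞ M] {k : ℕ}

/-- The map `T_z M → ℝⁿ` taking a tangent vector to its coordinates in the chart at `x`. -/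
def coframe (x z : M) : TangentSpace (𝓡 n) z →L[ℝ] E n := tangentCoordChange (𝓡 n) z x z

open Classical in
/-- The form on `M` with a given expression in the chart at `x`, zero outside the chart. -/
def extendRaw (x : M) (η : E n → (E n) [⋀^Fin k]→L[ℝ] ℝ) : RawForm n M k := fun z =>
  if z ∈ (chart (n := n) x).source then
    (η (chart (n := n) x z)).compContinuousLinearMap (coframe x z) else 0

lemma inChart_extendRaw (x : M) (η : E n → (E n) [⋀^Fin k]→L[ℝ] ℝ) {y : E n}
    (hy : y ∈ (chart x).target) : inChart (extendRaw x η) x y = η y := by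
  have hs : (chart x).symm y ∈ (chart (n := n) x).source := (chart x).map_target hy
  have hr : chart (n := n) x ((chart x).symm y) = y := (chart x).right_inv hy
  rw [inChart, extendRaw, if_pos hs, hr]
  ext v
  change η y (fun i => coframe x ((chart x).symm y) (frame x y (v i))) = η y v
  congr 1
  funext i
  exact coordChange_frame x hy (v i)

lemma inChart_eq_zero (α : RawForm n M k) (x : M) (y : E n) (h : α ((chart x).symm y) = 0) :
    inChart α x y = 0 := by
  ext v
  simp [inChart, h]

lemma contDiffOn_comp_transition {x z : M} {η : E n → (E n) [⋀^Fin k]→L[ℝ] ℝ}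
    (hη : ContDiffOn ℝ ∞ η (chart (n := n) z).target) {y : E n} (hy : y ∈ (chart x).target)
    (hz : (chart x).symm y ∈ (chart (n := n) z).source) :
    ContDiffAt ℝ ∞ (fun y' => (η ((chart (n := n) z ∘ (chart x).symm) y')).compContinuousLinearMap
      (transition x z y')) y := by
  set W := (chart (n := n) x).target ∩ (chart x).symm ⁻¹' (chart (n := n) z).source
  have hW : IsOpen W := (continuousOn_extChartAt_symm (I := 𝓡 n) x).isOpen_inter_preimage
    (isOpen_extChartAt_target (I := 𝓡 n) x) (isOpen_extChartAt_source (I := 𝓡 n) z)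
  have hF : ∀ y ∈ W, ContDiffAt ℝ ∞ (chart (n := n) z ∘ (chart x).symm) y := fun y hy =>
    coordChange_contDiffAt x z hy.1 hy.2
  have hη' : ContDiffOn ℝ ∞ (fun y' => η ((chart (n := n) z ∘ (chart x).symm) y')) W :=
    fun y hy => ((hη.contDiffAt ((isOpen_extChartAt_target (I := 𝓡 n) z).mem_nhds
      ((chart (n := n) z).map_source hy.2))).comp y (hF y hy)).contDiffWithinAt
  have hT : ∀ i j, ContDiffOn ℝ ∞ (fun y' => matOf (transition x z y') i j) W := by
    intro i j y hy
    have h : ∀ y', matOf (transition x z y') i j = (transition x z y' (e j)) i := by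
      intro y'
      conv_rhs => rw [← matCLM_matOf (transition x z y'), matCLM_e]
      simp [e_apply]
    have hT : ContDiffAt ℝ ∞ (transition x z) y := (hF y hy).fderiv_right (m := ∞) le_rfl
    simp only [h]
    exact ((EuclideanSpace.proj (𝕜 := ℝ) i).contDiff.contDiffAt.comp y
      (hT.clm_apply contDiffAt_const)).contDiffWithinAt
  have h := contDiffOn_comp_matCLM hη' hT
  simp only [matCLM_matOf] at h
  exact h.contDiffAt (hW.mem_nhds ⟨hy, hz⟩)

/-- Inside the chart domain smoothness is carried over by the transition maps; a point outside it
has a neighbourhood disjoint from the closed set `K`, where the extension is zero. -/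
lemma extendRaw_mem [T2Space M] (x : M) {η : E n → (E n) [⋀^Fin k]→L[ℝ] ℝ} {K : Set M}
    (hη : ContDiffOn ℝ ∞ η (chart (n := n) x).target) (hK : IsClosed K)
    (hKx : K ⊆ (chart (n := n) x).source)
    (h0 : ∀ y ∈ (chart x).target, (chart x).symm y ∉ K → η y = 0) :
    extendRaw x η ∈ smoothForms n M k := by
  have hz0 : ∀ z ∉ K, extendRaw x η z = 0 := by
    intro z hz
    by_cases hs : z ∈ (chart (n := n) x).source
    · rw [extendRaw, if_pos hs, h0 _ ((chart (n := n) x).map_source hs)]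
      · ext v; rfl
      · have : (chart x).symm (chart (n := n) x z) = z := (chart x).left_inv hs
        rwa [this]
    · rw [extendRaw, if_neg hs]
  intro z y hy
  refine ContDiffAt.contDiffWithinAt ?_
  by_cases hs : (chart z).symm y ∈ (chart (n := n) x).source
  · refine ContDiffAt.congr_of_eventuallyEq ?_ (inChart_eventuallyEq (extendRaw x η) z x hy hs)
    exact contDiffOn_comp_transition (hη.congr fun y' hy' => inChart_extendRaw x η hy') hy hs
  · have hcont : ContinuousAt (chart (n := n) z).symm y :=
      (continuousOn_extChartAt_symm (I := 𝓡 n) z).continuousAt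
        ((isOpen_extChartAt_target (I := 𝓡 n) z).mem_nhds hy)
    refine contDiffAt_const (c := 0) |>.congr_of_eventuallyEq ?_
    filter_upwards [hcont.preimage_mem_nhds (hK.isOpen_compl.mem_nhds fun h => hs (hKx h))]
      with y' hy'
    exact inChart_eq_zero _ _ _ (hz0 _ hy')

lemma inChart_smul_fun (ρ : M → ℝ) (α : RawForm n M k) (x : M) (y : E n) :
    inChart (fun z => ρ z • α z) x y = ρ ((chart x).symm y) • inChart α x y := by
  ext v
  simp [inChart]

/-- Multiplication of forms by a smooth function. -/
def smulForm (ρ : ContMDiffMap (𝓡 n) 𝓘(ℝ, ℝ) M ℝ ∞) : Form n M k →ₗ[ℝ] Form n M k where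
  toFun α := ⟨fun z => ρ z • α.1 z, fun x => by
    have h : ContDiffOn ℝ ∞ (fun y => ρ ((chart (n := n) x).symm y)) (chart (n := n) x).target :=
      contMDiffOn_iff_contDiffOn.1
        (ρ.contMDiff.comp_contMDiffOn (contMDiffOn_extChartAt_symm (I := 𝓡 n) x))
    exact (h.smul (α.2 x)).congr fun y _ => inChart_smul_fun ρ α.1 x y⟩
  map_add' α β := Subtype.ext (funext fun z => smul_add (ρ z) (α.1 z) (β.1 z))
  map_smul' c α := Subtype.ext (funext fun z => smul_comm (ρ z) c (α.1 z))

end Extension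

/-! ### The codifferential of a form cut off to a chart -/

namespace Metric

variable {n : ℕ} {M : Type*} [TopologicalSpace M] [ChartedSpace (E n) M]
  [IsManifold (𝓡 n) ∞ M] (g : Metric n M) {k : ℕ}

/-- The formal adjoint of `d` in the chart at `x`, in coordinates. -/
def chartCodiff (x : M) (ψ : Form n M (k + 1)) : E n → (E n) [⋀^Fin k]→L[ℝ] ℝ :=
  coordCodiff (g.coeff x) (g.density x) (inChart ψ.1 x)

lemma contDiffOn_chartCodiff (x : M) (ψ : Form n M (k + 1)) :
    ContDiffOn ℝ ∞ (g.chartCodiff x ψ) (chart (n := n) x).target :=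
  contDiffOn_coordCodiff (isOpen_extChartAt_target (I := 𝓡 n) x) (g.contDiffOn_coeff x)
    (fun _ hy => g.det_coeff_ne_zero x hy) (g.contDiffOn_density x)
    (fun _ hy => (g.density_pos x hy).ne') (ψ.2 x)

lemma differentiableAt_raised (x : M) (ψ : Form n M k) {y : E n} (hy : y ∈ (chart x).target) :
    DifferentiableAt ℝ (raised (g.coeff x) (g.density x) (inChart ψ.1 x)) y :=
  ((contDiffOn_raised (g.contDiffOn_coeff x) (fun _ hy => g.det_coeff_ne_zero x hy)
    (g.contDiffOn_density x) (ψ.2 x)).contDiffAt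
      ((isOpen_extChartAt_target (I := 𝓡 n) x).mem_nhds hy)).differentiableAt (by simp)

lemma chartCodiff_add (x : M) (ψ ψ' : Form n M (k + 1)) {y : E n} (hy : y ∈ (chart x).target) :
    g.chartCodiff x (ψ + ψ') y = g.chartCodiff x ψ y + g.chartCodiff x ψ' y := by
  have h : raised (g.coeff x) (g.density x) (inChart (ψ + ψ').1 x) =
      raised (g.coeff x) (g.density x) (inChart ψ.1 x) +
        raised (g.coeff x) (g.density x) (inChart ψ'.1 x) := by
    funext y'
    change g.density x y' • (inChart (ψ.1 + ψ'.1) x y').compContinuousLinearMap _ = _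
    rw [inChart_add]
    ext v
    simp [raised, mul_add]
  rw [chartCodiff, coordCodiff, h, fderiv_add (g.differentiableAt_raised x ψ hy)
    (g.differentiableAt_raised x ψ' hy)]
  ext v
  simp [chartCodiff, coordCodiff, Finset.sum_add_distrib]

lemma chartCodiff_smul (x : M) (c : ℝ) (ψ : Form n M (k + 1)) (y : E n) :
    g.chartCodiff x (c • ψ) y = c • g.chartCodiff x ψ y := by
  have h : raised (g.coeff x) (g.density x) (inChart (c • ψ).1 x) =
      c • raised (g.coeff x) (g.density x) (inChart ψ.1 x) := by
    funext y'
    change g.density x y' • (inChart (c • ψ.1) x y').compContinuousLinearMap _ = _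
    rw [inChart_smul]
    ext v
    simp [raised]
    ring
  have h2 : ∀ R : E n → (E n) [⋀^Fin (k + 1)]→L[ℝ] ℝ, fderiv ℝ (c • R) y = c • fderiv ℝ R y :=
    fun R => congrFun (fderiv_const_smul_field (f := R) c) y
  rw [chartCodiff, coordCodiff, h, h2]
  ext v
  simp [chartCodiff, coordCodiff, ← Finset.mul_sum]
  ring

/-- A differential operator does not enlarge supports; this is what allows the result to be extended
by zero. -/
lemma chartCodiff_eq_zero (x : M) (ψ : Form n M (k + 1)) {K : Set M} (hK : IsClosed K)
    (h0 : ∀ z ∉ K, ψ.1 z = 0) {y : E n} (hy : y ∈ (chart x).target)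
    (hyK : (chart x).symm y ∉ K) : g.chartCodiff x ψ y = 0 := by
  have hcont : ContinuousAt (chart (n := n) x).symm y :=
    (continuousOn_extChartAt_symm (I := 𝓡 n) x).continuousAt
      ((isOpen_extChartAt_target (I := 𝓡 n) x).mem_nhds hy)
  have h : raised (g.coeff x) (g.density x) (inChart ψ.1 x) =ᶠ[𝓝 y] fun _ => 0 := by
    filter_upwards [hcont.preimage_mem_nhds (hK.isOpen_compl.mem_nhds hyK)] with y' hy'
    rw [raised, inChart_eq_zero _ _ _ (h0 _ hy')]
    ext v
    simp
  rw [chartCodiff, coordCodiff, h.fderiv_eq]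
  ext v
  simp

variable [T2Space M]

/-- The formal adjoint of `d`, on forms cut off to a chart domain. -/
def cutoffCodiff (x : M) (ρ : ContMDiffMap (𝓡 n) 𝓘(ℝ, ℝ) M ℝ ∞)
    (hρ : tsupport ρ ⊆ (chart (n := n) x).source) : Form n M (k + 1) →ₗ[ℝ] Form n M k where
  toFun ψ := ⟨extendRaw x (g.chartCodiff x (smulForm ρ ψ)),
    extendRaw_mem x (g.contDiffOn_chartCodiff x _) (isClosed_tsupport ρ) hρ fun y hy hyK =>
      g.chartCodiff_eq_zero x _ (isClosed_tsupport ρ) (fun z hz => by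
        change ρ z • ψ.1 z = 0
        rw [image_eq_zero_of_notMem_tsupport hz, zero_smul]) hy hyK⟩
  map_add' ψ ψ' := by
    refine Subtype.ext (funext fun z => ?_)
    change extendRaw x _ z = extendRaw x _ z + extendRaw x _ z
    by_cases hz : z ∈ (chart (n := n) x).source
    · simp only [extendRaw, if_pos hz]
      rw [map_add, chartCodiff_add _ _ _ _ ((chart (n := n) x).map_source hz)]
      ext v; rfl
    · simp [extendRaw, if_neg hz]
  map_smul' c ψ := by
    refine Subtype.ext (funext fun z => ?_)
    change extendRaw x _ z = c • extendRaw x _ z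
    by_cases hz : z ∈ (chart (n := n) x).source
    · simp only [extendRaw, if_pos hz]
      rw [map_smul, chartCodiff_smul]
      ext v; rfl
    · simp [extendRaw, if_neg hz]

end Metric

/-! ### Existence of the global adjoint -/

namespace Metric

variable {n : ℕ} {M : Type*} [TopologicalSpace M] [ChartedSpace (E n) M]
  [IsManifold (𝓡 n) ∞ M] (g : Metric n M) {k : ℕ}

lemma formInner_zero_right (z : M) (φ : (TangentSpace (𝓡 n) z) [⋀^Fin k]→L[ℝ] ℝ) :
    g.formInner z φ 0 = 0 := by
  simpa using g.formInner_smul_right z 0 φ 0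

variable [CompactSpace M] [MeasurableSpace M] [BorelSpace M]

lemma pairing_sum_right {ι : Type*} (s : Finset ι) (φ : Form n M k) (ψ : ι → Form n M k) :
    g.pairing φ (∑ i ∈ s, ψ i) = ∑ i ∈ s, g.pairing φ (ψ i) := by
  classical
  induction s using Finset.induction_on with
  | empty => simpa using g.pairing_smul_right 0 φ 0
  | insert a s ha ih => rw [Finset.sum_insert ha, Finset.sum_insert ha, pairing_add_right, ih]

variable [T2Space M]

/-- Both integrands vanish outside the chart, so the difference of the two sides is an integral over
the chart target. There it is a divergence supported in the compact image of `tsupport ρ`, so it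
integrates to zero. -/
lemma pairing_cutoffCodiff (x : M) (ρ : ContMDiffMap (𝓡 n) 𝓘(ℝ, ℝ) M ℝ ∞)
    (hρ : tsupport ρ ⊆ (chart (n := n) x).source) (φ : Form n M k) (ψ : Form n M (k + 1)) :
    g.pairing (d n M k φ) (smulForm ρ ψ) = g.pairing φ (g.cutoffCodiff x ρ hρ ψ) := by
  set χ : Form n M (k + 1) := smulForm ρ ψ
  set θ : Form n M k := g.cutoffCodiff x ρ hρ ψ
  have hU : IsOpen (chart (n := n) x).target := isOpen_extChartAt_target (I := 𝓡 n) x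
  have hχ0 : ∀ z ∉ tsupport ρ, χ.1 z = 0 := fun z hz => by
    change ρ z • ψ.1 z = 0
    rw [image_eq_zero_of_notMem_tsupport hz, zero_smul]
  have hθ0 : ∀ z ∉ (chart (n := n) x).source, θ.1 z = 0 := fun z hz => if_neg hz
  have hθc : ∀ y ∈ (chart x).target, inChart θ.1 x y = g.chartCodiff x χ y := fun y hy =>
    inChart_extendRaw x _ hy
  have hk : (k.factorial : ℝ) ≠ 0 := Nat.cast_ne_zero.2 k.factorial_ne_zero
  rw [← sub_eq_zero, pairing, pairing, ← MeasureTheory.integral_sub (g.integrable_formInner _ _)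
    (g.integrable_formInner _ _), g.integral_volume_of_eq_zero_off_source x
      ((g.continuous_formInner _ _).fun_sub (g.continuous_formInner _ _))]
  swap
  · intro z hz
    rw [hχ0 z fun h => hz (hρ h), hθ0 z hz, formInner_zero_right, formInner_zero_right, sub_zero]
  have hK : IsCompact (chart (n := n) x '' tsupport ρ) :=
    ((isClosed_tsupport ρ).isCompact).image_of_continuousOn
      ((continuousOn_extChartAt (I := 𝓡 n) x).mono hρ)
  have hKU : chart (n := n) x '' tsupport ρ ⊆ (chart (n := n) x).target := by
    rintro _ ⟨z, hz, rfl⟩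
    exact (chart (n := n) x).map_source (hρ hz)
  have h0 : ∀ y ∈ (chart (n := n) x).target, (g.coeff x y).det ≠ 0 := fun y hy =>
    g.det_coeff_ne_zero x hy
  have hr := contDiffOn_raised (g.contDiffOn_coeff x) h0 (g.contDiffOn_density x) (χ.2 x)
  have hX : ∀ c, ContDiffOn ℝ ∞ (fun y => dotForm (inChart φ.1 x y)
      (contractCLM (e c) (raised (g.coeff x) (g.density x) (inChart χ.1 x) y)))
      (chart (n := n) x).target := fun c =>
    ContDiffOn.sum fun a _ => (contDiffOn_form_apply (φ.2 x) _).mul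
      (contDiffOn_form_apply ((contractCLM (e c)).contDiff.comp_contDiffOn hr) _)
  have hX0 : ∀ c, ∀ y ∈ (chart (n := n) x).target, y ∉ chart (n := n) x '' tsupport ρ →
      dotForm (inChart φ.1 x y)
        (contractCLM (e c) (raised (g.coeff x) (g.density x) (inChart χ.1 x) y)) = 0 := by
    intro c y hy hyK
    have hz : (chart x).symm y ∉ tsupport ρ := fun h => hyK ⟨_, h, (chart x).right_inv hy⟩
    have hr0 : raised (g.coeff x) (g.density x) (inChart χ.1 x) y = 0 := by
      rw [raised, inChart_eq_zero _ _ _ (hχ0 _ hz)]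
      ext v
      simp
    rw [hr0, map_zero]
    simp [dotForm]
  have hdiv := fun c => setIntegral_fderiv_apply_eq_zero hU hK hKU (hX c) (hX0 c) (e c)
  have hsum : ∀ y ∈ (chart (n := n) x).target,
      g.density x y * (g.formInner ((chart x).symm y) ((d n M k φ).1 ((chart x).symm y))
        (χ.1 ((chart x).symm y)) - g.formInner ((chart x).symm y) (φ.1 ((chart x).symm y))
        (θ.1 ((chart x).symm y))) =
      (k.factorial : ℝ)⁻¹ * ∑ c, fderiv ℝ (fun y => dotForm (inChart φ.1 x y)
        (contractCLM (e c) (raised (g.coeff x) (g.density x) (inChart χ.1 x) y))) y (e c) := by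
    intro y hy
    rw [sum_fderiv_dotForm_contract hU (g.contDiffOn_coeff x) h0 (g.contDiffOn_density x)
      (fun y hy => (g.density_pos x hy).ne') (φ.2 x) (χ.2 x) hy, inv_mul_cancel_left₀ hk,
      formInner_eq_matInner _ _ _ _ hy, formInner_eq_matInner _ _ _ _ hy, hθc y hy]
    have : inChart (d n M k φ).1 x y = extDeriv (inChart φ.1 x) y := inChart_rawExtDeriv φ x hy
    rw [this]
    rfl
  rw [MeasureTheory.setIntegral_congr_fun hU.measurableSet hsum, MeasureTheory.integral_const_mul,
    MeasureTheory.integral_finsetSum _ fun c _ => (hdiv c).1,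
    Finset.sum_eq_zero fun c _ => (hdiv c).2, mul_zero]

/-- The formal adjoint of the exterior derivative exists. -/
theorem exists_adjoint (k : ℕ) : ∃ D : Form n M (k + 1) →ₗ[ℝ] Form n M k,
    ∀ φ ψ, g.pairing (d n M k φ) ψ = g.pairing φ (D ψ) := by
  obtain ⟨f, hf⟩ := SmoothPartitionOfUnity.exists_isSubordinate (𝓡 n) (M := M) isClosed_univ
    (fun x : M => (chart (n := n) x).source) (fun x => isOpen_extChartAt_source (I := 𝓡 n) x)
    (fun x _ => mem_iUnion.2 ⟨x, mem_extChartAt_source x⟩)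
  -- By compactness only finitely many members of the partition are not identically zero, so the
  -- operators can be summed.
  set s := f.locallyFinite.finite_nonempty_of_compact.toFinset with hs
  refine ⟨∑ x ∈ s, g.cutoffCodiff x (f x) (hf x), fun φ ψ => ?_⟩
  have hψ : ψ = ∑ x ∈ s, smulForm (f x) ψ := by
    refine Subtype.ext (funext fun z => ?_)
    have h1 : (∑ x ∈ s, smulForm (f x) ψ).1 z = ∑ x ∈ s, f x z • ψ.1 z := by
      have h2 : ∀ t : Finset M, (∑ x ∈ t, smulForm (f x) ψ).1 z = ∑ x ∈ t, f x z • ψ.1 z := by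
        classical
        intro t
        induction t using Finset.induction_on with
        | empty => rfl
        | insert a t ha ih =>
          rw [Finset.sum_insert ha, Finset.sum_insert ha, ← ih]
          rfl
      exact h2 s
    have h3 : ∑ x ∈ s, f x z = 1 := by
      rw [← f.sum_eq_one (mem_univ z)]
      refine (finsum_eq_sum_of_support_subset _ fun x hx => ?_).symm
      rw [hs, Finite.coe_toFinset]
      exact ⟨z, hx⟩
    rw [h1, ← Finset.sum_smul, h3, one_smul]
  conv_lhs => rw [hψ]
  rw [pairing_sum_right, LinearMap.sum_apply, pairing_sum_right]
  exact Finset.sum_congr rfl fun x _ => g.pairing_cutoffCodiff x (f x) (hf x) φ ψ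

/-- The codifferential is the formal adjoint of the exterior derivative. -/
theorem pairing_d_left (φ : Form n M k) (ψ : Form n M (k + 1)) :
    g.pairing (d n M k φ) ψ = g.pairing φ (g.codiff (k + 1) ψ) := by
  have h := g.exists_adjoint k
  change _ = g.pairing φ (g.adjointD k ψ)
  -- `adjointD` has the default value `0`; existence excludes that branch, and the chosen operator
  -- has the adjoint property whether or not it is unique.
  rw [adjointD, dif_pos h]
  exact h.choose_spec φ ψ

end Metric

/-! ### Products of shifts of one operator -/

section LinearAlgebra

variable {V : Type*} [AddCommGroup V] [Module ℝ V] (A : Module.End ℝ V) (c : ℕ → ℝ)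

/-- The product of the operators `A + cᵢ` for `i < m`. -/
def shiftProd (m : ℕ) : Module.End ℝ V :=
  ((List.range m).map fun i => A + c i • (1 : Module.End ℝ V)).prod

lemma shiftProd_succ (m : ℕ) :
    shiftProd A c (m + 1) = shiftProd A c m * (A + c m • (1 : Module.End ℝ V)) := by
  simp [shiftProd, List.range_succ]

/-- The roots are `-cᵢ`; as a polynomial in `A` the product is open to coprimality arguments. -/
lemma shiftProd_eq_aeval (m : ℕ) : shiftProd A c m =
    Polynomial.aeval A (∏ i ∈ Finset.range m, (Polynomial.X - Polynomial.C (-c i))) := by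
  induction m with
  | zero => simp [shiftProd]
  | succ m ih =>
    rw [shiftProd_succ, Finset.prod_range_succ, map_mul, ← ih]
    simp [Algebra.algebraMap_eq_smul_one]

lemma shiftProd_apply_of_apply_eq_zero (m : ℕ) {u : V} (hu : A u = 0) :
    shiftProd A c m u = (∏ i ∈ Finset.range m, c i) • u := by
  induction m with
  | zero => simp [shiftProd]
  | succ m ih =>
    rw [shiftProd_succ, Finset.prod_range_succ]
    simp [hu, ih, smul_smul, mul_comm]

/-- For coprime `p` and `q` the kernel of `p(A) q(A)` is the sum of the kernels; distinct shifts
make each new factor coprime to the product so far. The space may be infinite-dimensional. -/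
lemma ker_shiftProd (m : ℕ) (hc : ∀ i < m, ∀ j < m, c i = c j → i = j) :
    LinearMap.ker (shiftProd A c m) =
      ⨆ i ∈ Finset.range m, LinearMap.ker (A + c i • (1 : Module.End ℝ V)) := by
  induction m with
  | zero =>
    have : LinearMap.ker (1 : Module.End ℝ V) = ⊥ := LinearMap.ker_id
    simp [shiftProd, this]
  | succ m ih =>
    have hcop : IsCoprime (∏ i ∈ Finset.range m, (Polynomial.X - Polynomial.C (-c i)))
        (Polynomial.X - Polynomial.C (-c m)) := by
      refine IsCoprime.prod_left fun i hi => Polynomial.isCoprime_X_sub_C_of_isUnit_sub ?_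
      have hi' := Finset.mem_range.1 hi
      refine isUnit_iff_ne_zero.2 fun h => hi'.ne (hc i (by omega) m (by omega) ?_)
      linarith
    have h := Polynomial.sup_ker_aeval_eq_ker_aeval_mul_of_coprime A hcop
    rw [← Finset.prod_range_succ, ← shiftProd_eq_aeval, ← shiftProd_eq_aeval,
      ih fun i hi j hj => hc i (by omega) j (by omega)] at h
    rw [← h, Finset.range_add_one, Finset.iSup_insert, sup_comm]
    congr 2
    simp [Algebra.algebraMap_eq_smul_one]

lemma shiftProd_mem (m : ℕ) {W : Submodule ℝ V} (hA : ∀ v, A v ∈ W) {u : V} (hu : u ∈ W) :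
    shiftProd A c m u ∈ W := by
  induction m generalizing u with
  | zero => simpa [shiftProd] using hu
  | succ m ih =>
    rw [shiftProd_succ]
    exact ih (W.add_mem (hA u) (W.smul_mem _ hu))

lemma apply_eq_of_mem_ker_add_smul {t : ℝ} (ht : t ≠ 0) {u : V}
    (hu : u ∈ LinearMap.ker (A + t • (1 : Module.End ℝ V))) : A (-t⁻¹ • u) = u := by
  have h : A u + t • u = 0 := hu
  rw [map_smul, eq_neg_of_add_eq_zero_left h, smul_neg, neg_smul, neg_neg, smul_smul,
    inv_mul_cancel₀ ht, one_smul]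

/-- An eigenvector with nonzero eigenvalue is the image of a multiple of itself. -/
lemma ker_shiftProd_le_range (m : ℕ) (hc : ∀ i < m, ∀ j < m, c i = c j → i = j)
    (h0 : ∀ i < m, c i ≠ 0) : LinearMap.ker (shiftProd A c m) ≤ LinearMap.range A := by
  rw [ker_shiftProd A c m hc]
  exact iSup₂_le fun i hi u hu =>
    ⟨_, apply_eq_of_mem_ker_add_smul A (h0 i (Finset.mem_range.1 hi)) hu⟩

end LinearAlgebra

/-! ### Einstein metrics: the constants, the decomposition and the quadratic form -/

namespace Metric

lemma factor_pos {n k i : ℕ} (h1 : 1 ≤ i) (h2 : i ≤ (n - 2 * k) / 2) : 0 < factor n k i := by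
  have hi : (1 : ℝ) ≤ i := by exact_mod_cast h1
  have h : 2 * i + 2 * k ≤ n := by omega
  have h' : 2 * (i : ℝ) + 2 * k ≤ n := by exact_mod_cast h
  have hk : (0 : ℝ) ≤ k := Nat.cast_nonneg k
  unfold factor
  have : 0 < (n : ℝ) - 2 * k - i + 1 := by linarith
  have hn : 0 < (n : ℝ) := by linarith
  positivity

/-- The factors at `i` and `j` differ by `2/n` times `(i - j)(n - 2k + 1 - i - j)`. In the given
range `i + j ≤ n - 2k`, so the second factor is at least `1`. The bound `1 ≤ i` forces `n ≠ 0`, so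
that the division by `n` is genuine. -/
lemma factor_injOn {n k i j : ℕ} (hi1 : 1 ≤ i) (hi : i ≤ (n - 2 * k) / 2)
    (hj : j ≤ (n - 2 * k) / 2) (h : factor n k i = factor n k j) : i = j := by
  have h1 : 2 * i + 2 * k ≤ n := by omega
  have h2 : 2 * j + 2 * k ≤ n := by omega
  have h1' : 2 * (i : ℝ) + 2 * k ≤ n := by exact_mod_cast h1
  have h2' : 2 * (j : ℝ) + 2 * k ≤ n := by exact_mod_cast h2
  have hn : (n : ℝ) ≠ 0 := Nat.cast_ne_zero.2 (by omega)
  rw [factor, factor, div_left_inj' hn] at h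
  have h3 : ((i : ℝ) - j) * (n - 2 * k + 1 - i - j) = 0 := by linear_combination h / 2
  rcases mul_eq_zero.1 h3 with h4 | h4
  · exact_mod_cast sub_eq_zero.1 h4
  · linarith

variable {n : ℕ} {M : Type*} [TopologicalSpace M] [ChartedSpace (E n) M]
  [IsManifold (𝓡 n) ∞ M] (g : Metric n M) {k : ℕ}

lemma det_gram_ne_zero (z : M) : (g.gram z).det ≠ 0 :=
  g.det_coeff_ne_zero z (mem_extChartAt_target z)

lemma trace_gram (z : M) : g.trace z (g.gram z) = n := by
  have h : g.trace z (g.gram z) = ((g.gram z)⁻¹ * (g.gram z).transpose).trace := by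
    simp [trace, Matrix.trace, Matrix.mul_apply]
  have ht : (g.gram z).transpose = g.gram z := g.coeff_transpose z _
  rw [h, ht, Matrix.nonsing_inv_mul _ (isUnit_iff_ne_zero.2 (g.det_gram_ne_zero z)),
    Matrix.trace_one, Fintype.card_fin]

lemma trace_const_mul_gram (z : M) (t : ℝ) :
    g.trace z (fun i j => t * g.gram z i j) = t * n := by
  rw [← g.trace_gram z]
  simp only [trace, Finset.mul_sum]
  exact Finset.sum_congr rfl fun i _ => Finset.sum_congr rfl fun j _ => by ring

/-- The trace of the Schouten tensor of an Einstein metric. -/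
lemma schoutenTrace_of_ricci_eq (hn : 3 ≤ n) {c : ℝ} {z : M}
    (h : ∀ i j, g.ricci z i j = c * g.gram z i j) :
    g.schoutenTrace z = n * c / (2 * (n - 1)) := by
  have hn' : (3 : ℝ) ≤ n := by exact_mod_cast hn
  have h2 : (n : ℝ) - 2 ≠ 0 := by linarith
  have h1 : (n : ℝ) - 1 ≠ 0 := by linarith
  have hr : g.ricci z = fun i j => c * g.gram z i j := by
    funext i j
    exact h i j
  have hs : g.scalarCurvature z = n * c := by
    rw [scalarCurvature, hr, trace_const_mul_gram, mul_comm]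
  -- The coefficient equals `c / (2(n - 1))`, so `P` is a constant multiple of `g`.
  have hP : g.schouten z = fun i j =>
      ((1 / ((n : ℝ) - 2)) * (c - n * c / (2 * (n - 1)))) * g.gram z i j := by
    funext i j
    rw [schouten, hs, h]
    ring
  rw [schoutenTrace, hP, trace_const_mul_gram]
  field_simp
  ring

/-- The derivative at each point is taken in that point's own chart; naturality replaces these by a
single chart near `z`, where the flat `d² = 0` applies. -/
lemma d_d (α : Form n M k) : d n M (k + 1) (d n M k α) = 0 := by
  refine Subtype.ext (funext fun z => ?_)
  change extDeriv (inChart (rawExtDeriv α.1) z) (chart (n := n) z z) = 0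
  have hT : (chart (n := n) z).target ∈ 𝓝 (chart (n := n) z z) :=
    (isOpen_extChartAt_target (I := 𝓡 n) z).mem_nhds (mem_extChartAt_target z)
  have h : inChart (rawExtDeriv α.1) z =ᶠ[𝓝 (chart (n := n) z z)] extDeriv (inChart α.1 z) := by
    filter_upwards [hT] with y hy
    exact inChart_rawExtDeriv α z hy
  have h2 : (2 : WithTop ℕ∞) ≤ ∞ := WithTop.coe_le_coe.2 (le_top : (2 : ℕ∞) ≤ ⊤)
  rw [h.extDeriv_eq]
  exact extDeriv_extDeriv_apply ((α.2 z).contDiffAt hT) (by simpa using h2)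

variable [MeasurableSpace M]

lemma dDelta_mem_closedForms (u : Form n M k) : g.dDelta k u ∈ closedForms n M k := by
  cases k with
  | zero => exact Submodule.zero_mem _
  | succ k => exact d_d (g.codiff (k + 1) u)

lemma dDelta_eq_zero {u : Form n M k} (hu : g.codiff k u = 0) : g.dDelta k u = 0 := by
  cases k with
  | zero => rfl
  | succ k => exact (congrArg (d n M k) hu).trans (map_zero _)

lemma Q_eq_shiftProd (J : ℝ) : g.Q J k =
    shiftProd (g.dDelta k) (fun i => factor n k (i + 1) * J) ((n - 2 * k) / 2) := rfl

lemma eigenforms_neg (t : ℝ) :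
    g.eigenforms k (-t) = LinearMap.ker (g.dDelta k + t • (1 : Module.End ℝ (Form n M k))) := by
  rw [eigenforms, neg_smul, sub_neg_eq_add]

lemma eigenforms_eq_eigenspace (t : ℝ) :
    g.eigenforms k t = (g.dDelta k).eigenspace t := by
  rw [Module.End.eigenspace_def, eigenforms]

lemma iSupIndep_eigenforms {J : ℝ} (hJ : J ≠ 0) (k : ℕ) :
    iSupIndep fun i : Finset.Icc 1 ((n - 2 * k) / 2) => g.eigenforms k (-(factor n k i * J)) := by
  simp only [eigenforms_eq_eigenspace]
  refine (Module.End.eigenspaces_iSupIndep (g.dDelta k)).comp fun i j h => Subtype.ext ?_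
  have hi := Finset.mem_Icc.1 i.2
  have hj := Finset.mem_Icc.1 j.2
  exact factor_injOn hi.1 hi.2 hj.2 (mul_right_cancel₀ hJ (neg_injective h))

lemma Icc_eq_image_range (m : ℕ) : Finset.Icc 1 m = (Finset.range m).image (· + 1) := by
  ext i
  simp only [Finset.mem_Icc, Finset.mem_image, Finset.mem_range]
  exact ⟨fun h => ⟨i - 1, by omega, by omega⟩, by rintro ⟨j, hj, rfl⟩; omega⟩

variable (n k) in
lemma sConst_mul_pow (J : ℝ) : sConst n k * J ^ ((n - 2 * k) / 2) =
    ∏ i ∈ Finset.range ((n - 2 * k) / 2), factor n k (i + 1) * J := by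
  rw [sConst, Icc_eq_image_range, Finset.prod_image (fun _ _ _ _ h => Nat.succ_injective h),
    Finset.prod_mul_distrib, Finset.prod_const, Finset.card_range]

lemma sConst_mul_pow_ne_zero {J : ℝ} (hJ : J ≠ 0) :
    sConst n k * J ^ ((n - 2 * k) / 2) ≠ 0 :=
  mul_ne_zero (Finset.prod_ne_zero_iff.2 fun _ hi =>
    (factor_pos (Finset.mem_Icc.1 hi).1 (Finset.mem_Icc.1 hi).2).ne') (pow_ne_zero _ hJ)

lemma factor_mul_injOn {J : ℝ} (hJ : J ≠ 0) : ∀ i < (n - 2 * k) / 2, ∀ j < (n - 2 * k) / 2,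
    factor n k (i + 1) * J = factor n k (j + 1) * J → i = j := fun _ hi _ hj h =>
  Nat.succ_injective (factor_injOn (Nat.succ_pos _) hi hj (mul_right_cancel₀ hJ h))

lemma ker_Q {J : ℝ} (hJ : J ≠ 0) (k : ℕ) : LinearMap.ker (g.Q J k) =
    ⨆ i ∈ Finset.Icc 1 ((n - 2 * k) / 2), g.eigenforms k (-(factor n k i * J)) := by
  rw [Q_eq_shiftProd, ker_shiftProd _ _ _ (factor_mul_injOn hJ), Icc_eq_image_range,
    Finset.iSup_finset_image]
  simp only [eigenforms_neg]

/-- Used twice: it makes the kernel consist of closed forms, hence of conformal harmonics, and it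
makes the kernel orthogonal to the harmonics. -/
lemma ker_Q_le_range {J : ℝ} (hJ : J ≠ 0) (k : ℕ) :
    LinearMap.ker (g.Q J k) ≤ LinearMap.range (g.dDelta k) :=
  ker_shiftProd_le_range _ _ _ (factor_mul_injOn hJ) fun _ hi =>
    mul_ne_zero (factor_pos (Nat.succ_pos _) hi).ne' hJ

lemma Q_apply_of_codiff_eq_zero (J : ℝ) {u : Form n M k} (hu : g.codiff k u = 0) :
    g.Q J k u = (sConst n k * J ^ ((n - 2 * k) / 2)) • u := by
  rw [Q_eq_shiftProd, sConst_mul_pow,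
    shiftProd_apply_of_apply_eq_zero _ _ _ (g.dDelta_eq_zero hu)]

/-- Closedness survives because `dδ` has closed values; coclosedness of `Q_k u` is exactly the
condition `G_k u = 0`. -/
lemma Q_mem_harmonics {J : ℝ} {u : Form n M k} (hu : u ∈ g.conformalHarmonics J k) :
    g.Q J k u ∈ g.harmonics k :=
  ⟨shiftProd_mem _ _ _ g.dDelta_mem_closedForms hu.1, hu.2⟩

lemma harmonics_le_conformalHarmonics (J : ℝ) : g.harmonics k ≤ g.conformalHarmonics J k := by
  refine fun u hu => ⟨hu.1, ?_⟩
  have h : g.codiff k u = 0 := hu.2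
  change g.codiff k (g.Q J k u) = 0
  rw [Q_apply_of_codiff_eq_zero _ _ h, map_smul, h, smul_zero]

/-- The projection of the conformal harmonics onto the harmonics. -/
def harmonicProj (J : ℝ) (k : ℕ) : g.conformalHarmonics J k →ₗ[ℝ] g.harmonics k :=
  (sConst n k * J ^ ((n - 2 * k) / 2))⁻¹ •
    ((g.Q J k).domRestrict (g.conformalHarmonics J k)).codRestrict (g.harmonics k)
      fun u => g.Q_mem_harmonics u.2

lemma coe_harmonicProj (J : ℝ) (u : g.conformalHarmonics J k) :
    (g.harmonicProj J k u : Form n M k) =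
      (sConst n k * J ^ ((n - 2 * k) / 2))⁻¹ • g.Q J k u := rfl

lemma Q_eq_smul_harmonicProj {J : ℝ} (hJ : J ≠ 0) (u : g.conformalHarmonics J k) :
    g.Q J k u = (sConst n k * J ^ ((n - 2 * k) / 2)) • (g.harmonicProj J k u : Form n M k) := by
  rw [coe_harmonicProj, smul_inv_smul₀ (sConst_mul_pow_ne_zero hJ)]

lemma map_ker_harmonicProj {J : ℝ} (hJ : J ≠ 0) (k : ℕ) :
    (LinearMap.ker (g.harmonicProj J k)).map (g.conformalHarmonics J k).subtype =
      LinearMap.ker (g.Q J k) := by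
  ext u
  constructor
  · rintro ⟨v, hv, rfl⟩
    have h : g.harmonicProj J k v = 0 := hv
    change g.Q J k v = 0
    rw [g.Q_eq_smul_harmonicProj hJ, h, Submodule.coe_zero, smul_zero]
  · intro hu
    have h : g.Q J k u = 0 := hu
    obtain ⟨v, hv⟩ := g.ker_Q_le_range hJ k hu
    have hm : u ∈ g.conformalHarmonics J k := by
      refine ⟨hv ▸ g.dDelta_mem_closedForms v, ?_⟩
      change g.codiff k (g.Q J k u) = 0
      rw [h, map_zero]
    refine ⟨⟨u, hm⟩, ?_, rfl⟩
    refine Subtype.ext ?_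
    rw [coe_harmonicProj, h, smul_zero, Submodule.coe_zero]

lemma sub_harmonicProj_mem_ker_Q {J : ℝ} (hJ : J ≠ 0) (u : g.conformalHarmonics J k) :
    (u : Form n M k) - g.harmonicProj J k u ∈ LinearMap.ker (g.Q J k) := by
  have h : g.codiff k (g.harmonicProj J k u : Form n M k) = 0 := (g.harmonicProj J k u).2.2
  rw [LinearMap.mem_ker, map_sub, g.Q_apply_of_codiff_eq_zero J h, g.Q_eq_smul_harmonicProj hJ,
    sub_self]

variable [T2Space M] [CompactSpace M] [BorelSpace M]

/-- `⟨dδu, w⟩ = ⟨δu, δw⟩ = 0`. This is the only use of adjointness in the algebraic part. -/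
lemma pairing_dDelta_eq_zero (u : Form n M k) {w : Form n M k} (hw : g.codiff k w = 0) :
    g.pairing (g.dDelta k u) w = 0 := by
  have h0 : ∀ {k : ℕ} (φ : Form n M k), g.pairing φ 0 = 0 := fun φ => by
    simpa using g.pairing_smul_right 0 φ 0
  cases k with
  | zero =>
    have h := g.pairing_add_left 0 0 w
    rw [add_zero] at h
    exact left_eq_add.1 h
  | succ k =>
    exact (g.pairing_d_left (g.codiff (k + 1) u) w).trans ((congrArg _ hw).trans (h0 _))

/-- `Q_k w` is a multiple of the harmonic form `πw`, and `u - πu` lies in the range of `dδ`, hence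
pairs to zero with it. -/
lemma thetaTilde_eq {J : ℝ} (hJ : J ≠ 0) (u w : g.conformalHarmonics J k) :
    g.thetaTilde J k u w = sConst n k * J ^ ((n - 2 * k) / 2) *
      g.pairing (g.harmonicProj J k u : Form n M k) (g.harmonicProj J k w) := by
  obtain ⟨v, hv⟩ := g.ker_Q_le_range hJ k (g.sub_harmonicProj_mem_ker_Q hJ u)
  have hu : (u : Form n M k) = g.harmonicProj J k u + g.dDelta k v := by
    rw [hv, add_sub_cancel]
  rw [thetaTilde, g.Q_eq_smul_harmonicProj hJ, pairing_smul_right]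
  congr 1
  conv_lhs => rw [hu]
  rw [pairing_add_left, g.pairing_dDelta_eq_zero v (g.harmonicProj J k w).2.2, add_zero]

end Metric

end PseudoRiem

end


/-! ### The theorem -/

theorem mainTheorem9 {n : ℕ} (hn : Even n) (hn4 : 4 ≤ n)
    {M : Type*} [TopologicalSpace M] [T2Space M] [CompactSpace M]
    [ChartedSpace (EuclideanSpace ℝ (Fin n)) M] [IsManifold (𝓡 n) ∞ M]
    [MeasurableSpace M] [BorelSpace M]
    (g : PseudoRiem.Metric n M) (hE : g.IsEinstein) (hR : ¬ g.IsRicciFlat) :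
    ∃ J : ℝ, J ≠ 0 ∧ (∀ z : M, g.schoutenTrace z = J) ∧
      ∀ k : ℕ, k ≤ n / 2 →
        iSupIndep (fun i : Finset.Icc 1 ((n - 2 * k) / 2) =>
          g.eigenforms k (-(PseudoRiem.Metric.factor n k i * J))) ∧
        ∃ π : g.conformalHarmonics J k →ₗ[ℝ] g.harmonics k,
          (∀ u : g.harmonics k, ∃ hu : (u : PseudoRiem.Form n M k) ∈ g.conformalHarmonics J k,
            π ⟨u, hu⟩ = u) ∧
          (LinearMap.ker π).map (g.conformalHarmonics J k).subtype =
            ⨆ i ∈ Finset.Icc 1 ((n - 2 * k) / 2),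
              g.eigenforms k (-(PseudoRiem.Metric.factor n k i * J)) ∧
          ∀ u w : g.conformalHarmonics J k,
            g.thetaTilde J k u w =
              PseudoRiem.Metric.sConst n k * J ^ ((n - 2 * k) / 2) *
                g.pairing (π u : PseudoRiem.Form n M k) (π w) := by
  obtain ⟨c, hc⟩ := hE
  have hn' : (4 : ℝ) ≤ n := by exact_mod_cast hn4
  have hc0 : c ≠ 0 := by
    rintro rfl
    exact hR fun z i j => by rw [hc, zero_mul]
  have hJ : (n : ℝ) * c / (2 * (n - 1)) ≠ 0 :=
    div_ne_zero (mul_ne_zero (by linarith) hc0) (mul_ne_zero two_ne_zero (by linarith))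
  refine ⟨n * c / (2 * (n - 1)), hJ,
    fun z => g.schoutenTrace_of_ricci_eq (by omega) (hc z), fun k _ =>
    ⟨g.iSupIndep_eigenforms hJ k, g.harmonicProj _ k, fun u =>
      ⟨g.harmonics_le_conformalHarmonics _ u.2, Subtype.ext ?_⟩,
      (g.map_ker_harmonicProj hJ k).trans (g.ker_Q hJ k), g.thetaTilde_eq hJ⟩⟩
  -- On a harmonic form `Q_k` is multiplication by `sᵏ Jᵐ`, which the normalization of `π` undoes.
  rw [PseudoRiem.Metric.coe_harmonicProj, g.Q_apply_of_codiff_eq_zero _ u.2.2,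
    inv_smul_smul₀ (PseudoRiem.Metric.sConst_mul_pow_ne_zero hJ)]
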